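/- **Setting (C²MAB-T).** There are $m$ base arms, a set of actions $\boldsymbol{\mathcal S}$, and a class $\mathcal D$ of probability distributions on $[0,1]^m$. An unknown $D\in\mathcal D$ is fixed, with expectation vector $\mu=(\mu_1,\dots,\mu_m)$, $\mu_i=\mathbb E_{X\sim D}[X_i]$. In round $t=1,2,\dots$ the environment reveals a context $\mathcal S^{(t)}\subseteq\boldsymbol{\mathcal S}$ (an arbitrary fixed sequence of action spaces), the player chooses $S^{(t)}\in\mathcal S^{(t)}$, an independent sample $X^{(t)}\sim D$ is drawn, a random set $\tau_t\subseteq[m]$ of triggered arms is drawn from a distribution $D_{\rm trig}(S^{(t)},X^{(t)})$, and the player observes $X^{(t)}_i$ for $i\in\tau_t$ and gets the reward $R(S^{(t)},X^{(t)},\tau_t)$. Outcomes do not depend on being triggered: $\mathbb E[X_i\mid i\in\tau]=\mathbb E[X_i]$ for every action whenever $i$ is triggered with positive probability. The expected reward $\mathbb E[R(S,X,\tau)]$ depends only on $S$ and the expectation vector: it equals $r_S(\mu)$ for a function $r_S:[0,1]^m\to\mathbb R$. Let $p_i^S(\mu)$ be the probability that $S$ triggers arm $i$, and let $\mathrm{opt}^{(t)}(\mu)=\sup_{S\in\mathcal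 S^{(t)}}r_S(\mu)$. Assume that, at the true $\mu$, $r_S(\mu)\ge 0$ for all $S$ and $\mathrm{opt}^{(t)}(\mu)<\infty$ for all $t$. Let $\alpha,\beta\in[0,1]$, and let $\mathcal O$ be a (randomized) offline oracle which, for each context $\mathcal S^{(t)}$ and each $\mu'\in[0,1]^m$, outputs $S\in\mathcal S^{(t)}$ with $\Pr\{r_S(\mu')\ge\alpha\,\mathrm{opt}^{(t)}(\mu')\}\ge\beta$. **Algorithm C²-UCB.** Start with $T_i=0$, $\hat\mu_i=1$ for all $i$. In round $t$ set $\rho_i=\sqrt{3\ln t/(2T_i)}$ ($\rho_i=+\infty$ if $T_i=0$) and $\bar\mu_i=\min\{\hat\mu_i+\rho_i,1\}$, play $S^{(t)}\leftarrow\mathcal O(\mathcal S^{(t)},\bar\mu_1,\dots,\bar\mu_m)$ (with fresh oracle randomness in each round), and for each $i\in\tau_t$ update $T_i\leftarrow T_i+1$, then $\hat\mu_i\leftarrow\hat\mu_i+(X_i^{(t)}-\hat\mu_i)/T_i$. Its expected $(\alpha,\beta)$-approximation regret is $$\mathrm{Reg}_{\alpha,\beta}(T;\mu)=\sum_{t=1}^T\alpha\beta\,\mathrm{opt}^{(t)}(\mu)-\sum_{t=1}^T\mathbb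 E\big[r_{S^{(t)}}(\mu)\big].$$ **Gaps.** For $S\in\mathcal S^{(t)}$ let $\Delta^{(t)}_S=\max(0,\alpha\,\mathrm{opt}^{(t)}(\mu)-r_S(\mu))$. Let $\Delta^{i,T}_{\min}$ and $\Delta^{i,T}_{\max}$ be the infimum and the supremum of $\Delta_S^{(t)}$ over $t\in\{1,\dots,T\}$ and $S\in\mathcal S^{(t)}$ with $p_i^S(\mu)>0$ and $\Delta_S^{(t)}>0$ ($+\infty$ and $0$, respectively, if there is no such pair), $\Delta^{(T)}_{\min}=\min_i\Delta^{i,T}_{\min}$, $\Delta^{(T)}_{\max}=\max_i\Delta^{i,T}_{\max}$, and $K=\max_{t\le T,\,S\in\mathcal S^{(t)}}|\{i:p_i^S(\mu)>0\}|$. Write $\lceil x\rceil_0=\max\{\lceil x\rceil,0\}$, with $1/\infty=0$ and $\lceil\log_2 0\rceil_0=0$. **Theorem.** Assume monotonicity, i.e. $r_S(\mu')\le r_S(\mu'')$ for every action $S$ whenever $\mu',\mu''\in[0,1]^m$ and $\mu'_i\le\mu''_i$ for all $i$; and 1-norm TPM bounded smoothness with coefficient $C>0$, i.e. $|r_S(\mu)-r_S(\mu')|\le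 C\sum_{i\in[m]}p_i^S(\mu)|\mu_i-\mu_i'|$ for every action $S$, every expectation vector $\mu$ of a distribution in $\mathcal D$ and every $\mu'\in[0,1]^m$ (with $p_i^S(\mu)$ computed under that distribution). Then C²-UCB satisfies the following. (1) If $\Delta^{(T)}_{\min}>0$, then $$\mathrm{Reg}_{\alpha,\beta}(T;\mu)\le\sum_{i\in[m]}\frac{576\,C^2K\ln T}{\Delta^{i,T}_{\min}}+4Cm+\sum_{i\in[m]}\left(\left\lceil\log_2\frac{2CK}{\Delta^{i,T}_{\min}}\right\rceil_0+2\right)\frac{\pi^2}{6}\,\Delta^{(T)}_{\max}.$$ (2) For every $T\ge 2$, $$\mathrm{Reg}_{\alpha,\beta}(T;\mu)\le 12C\sqrt{mKT\ln T}+2Cm+\left(\left\lceil\log_2\frac{T}{18\ln T}\right\rceil_0+2\right)m\,\frac{\pi^2}{6}\,\Delta^{(T)}_{\max}.$$ -/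

import Mathlib

noncomputable section

namespace C2MAB

open MeasureTheory ProbabilityTheory Set
open scoped ENNReal

/-- The cube `[0,1]^m` of expectation vectors. -/
def cube (m : ℕ) : Set (Fin m → ℝ) := {μ | ∀ i, μ i ∈ Icc (0 : ℝ) 1}

/-- The expectation vector `μ_i = E_{X ∼ D}[X_i]`. -/
def meanVec {m : ℕ} (D : ProbabilityMeasure (Fin m → ℝ)) : Fin m → ℝ :=
  fun i => ∫ x, x i ∂(D : Measure (Fin m → ℝ))

/-- Joint law of the environment outcome `X ∼ D` and of the triggered set `τ ∼ D_trig(S, X)`,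
as a function of the action `S`. -/
def outcomeKernel {Act : Type*} [MeasurableSpace Act] {m : ℕ}
    (trig : Kernel (Act × (Fin m → ℝ)) (Set (Fin m))) (D : ProbabilityMeasure (Fin m → ℝ)) :
    Kernel Act ((Fin m → ℝ) × Set (Fin m)) :=
  Kernel.const Act (D : Measure (Fin m → ℝ)) ⊗ₖ trig

instance {Act : Type*} [MeasurableSpace Act] {m : ℕ}
    (trig : Kernel (Act × (Fin m → ℝ)) (Set (Fin m))) [IsMarkovKernel trig]
    (D : ProbabilityMeasure (Fin m → ℝ)) : IsMarkovKernel (outcomeKernel trig D) := by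
  unfold outcomeKernel; infer_instance

/-- A contextual combinatorial multi-armed bandit problem with probabilistically triggered arms:
full action space `Act`, base arms `Fin m`. The contexts are supplied separately, as a sequence
of subsets of `Act`. -/
structure Problem (Act : Type*) [MeasurableSpace Act] (m : ℕ) where
  /-- the class of possible joint distributions of the base arms, all on `[0,1]^m` -/
  distClass : Set (ProbabilityMeasure (Fin m → ℝ))
  ae_mem_cube : ∀ D ∈ distClass, ∀ᵐ x ∂(D : Measure (Fin m → ℝ)), x ∈ cube m
  /-- the law `D_trig(S, X)` of the triggered set -/
  trig : Kernel (Act × (Fin m → ℝ)) (Set (Fin m))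
  markov_trig : IsMarkovKernel trig
  /-- outcomes do not depend on being triggered: `E[X_i ∣ i ∈ τ] = E[X_i]` -/
  mean_cond_trig : ∀ D ∈ distClass, ∀ (S : Act) (i : Fin m),
    outcomeKernel trig D S {y | i ∈ y.2} ≠ 0 →
      ∫ y, y.1 i ∂((outcomeKernel trig D S)[|{y | i ∈ y.2}]) = meanVec D i
  /-- the reward `R(S, X, τ)` -/
  reward : Act → (Fin m → ℝ) → Set (Fin m) → ℝ
  integrable_reward : ∀ D ∈ distClass, ∀ S : Act,
    Integrable (fun y => reward S y.1 y.2) (outcomeKernel trig D S)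
  /-- the expected reward `r_S(μ)`, as a function of the action and the expectation vector
  `μ ∈ [0,1]^m`; by `r_mean` it is `E[R(S, X, τ)]` for every distribution of the class with
  expectation vector `μ` -/
  r : Act → (Fin m → ℝ) → ℝ
  measurable_r : ∀ μ ∈ cube m, Measurable (fun S => r S μ)
  r_mean : ∀ D ∈ distClass, ∀ S : Act,
    r S (meanVec D) = ∫ y, reward S y.1 y.2 ∂(outcomeKernel trig D S)

variable {Act : Type*} [MeasurableSpace Act] {m : ℕ}

instance (P : Problem Act m) : IsMarkovKernel P.trig := P.markov_trig

namespace Problem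

/-- `p_i^S(μ)`: the probability that action `S` triggers arm `i`. -/
def trigProb (P : Problem Act m) (D : ProbabilityMeasure (Fin m → ℝ)) (S : Act) (i : Fin m) : ℝ :=
  (outcomeKernel P.trig D S).real {y | i ∈ y.2}

/-- Monotonicity of the expected reward in the expectation vector. -/
def Monotonicity (P : Problem Act m) : Prop :=
  ∀ S : Act, ∀ μ ∈ cube m, ∀ μ' ∈ cube m, (∀ i, μ i ≤ μ' i) → P.r S μ ≤ P.r S μ'

/-- 1-norm triggering probability modulated bounded smoothness with coefficient `C`. -/
def TPM (P : Problem Act m) (C : ℝ) : Prop :=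
  ∀ D ∈ P.distClass, ∀ μ' ∈ cube m, ∀ S : Act,
    |P.r S (meanVec D) - P.r S μ'| ≤ C * ∑ i, P.trigProb D S i * |meanVec D i - μ' i|

/-- The optimal expected reward over the action space `A` under `μ`. -/
def opt (P : Problem Act m) (A : Set Act) (μ : Fin m → ℝ) : ℝ :=
  sSup ((fun S => P.r S μ) '' A)

/-- On the context `A`, the (randomized) oracle outputs, for every expectation vector, a feasible
action that is `α`-approximate with probability at least `β`. -/
def IsApproxOracle (P : Problem Act m) (α β : ℝ) (O : Set Act → Kernel (Fin m → ℝ) Act)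
    (A : Set Act) : Prop :=
  ∀ μ ∈ cube m, (∀ᵐ S ∂(O A μ), S ∈ A) ∧ β ≤ (O A μ).real {S | α * P.opt A μ ≤ P.r S μ}

/-- The reward gap `Δ_S = max(0, α · opt(μ) - r_S(μ))` of an action in the action space `A`. -/
def gap (P : Problem Act m) (α : ℝ) (D : ProbabilityMeasure (Fin m → ℝ)) (A : Set Act)
    (S : Act) : ℝ :=
  max 0 (α * P.opt A (meanVec D) - P.r S (meanVec D))

/-- `Δ_min^{i,T}`, equal to `∞` if there is no suitable action. -/
def gapMinArm (P : Problem Act m) (α : ℝ) (D : ProbabilityMeasure (Fin m → ℝ))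
    (ctx : ℕ → Set Act) (T : ℕ) (i : Fin m) : ℝ≥0∞ :=
  ⨅ t ∈ Finset.Icc 1 T, ⨅ S ∈ ctx t, ⨅ (_ : 0 < P.trigProb D S i),
    ⨅ (_ : 0 < P.gap α D (ctx t) S), ENNReal.ofReal (P.gap α D (ctx t) S)

/-- `Δ_max^{i,T}`, equal to `0` if there is no suitable action. -/
def gapMaxArm (P : Problem Act m) (α : ℝ) (D : ProbabilityMeasure (Fin m → ℝ))
    (ctx : ℕ → Set Act) (T : ℕ) (i : Fin m) : ℝ≥0∞ :=
  ⨆ t ∈ Finset.Icc 1 T, ⨆ S ∈ ctx t, ⨆ (_ : 0 < P.trigProb D S i),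
    ⨆ (_ : 0 < P.gap α D (ctx t) S), ENNReal.ofReal (P.gap α D (ctx t) S)

/-- `Δ_min^{(T)}`. -/
def gapMin (P : Problem Act m) (α : ℝ) (D : ProbabilityMeasure (Fin m → ℝ))
    (ctx : ℕ → Set Act) (T : ℕ) : ℝ≥0∞ :=
  ⨅ i, P.gapMinArm α D ctx T i

/-- `Δ_max^{(T)}`. -/
def gapMax (P : Problem Act m) (α : ℝ) (D : ProbabilityMeasure (Fin m → ℝ))
    (ctx : ℕ → Set Act) (T : ℕ) : ℝ≥0∞ :=
  ⨆ i, P.gapMaxArm α D ctx T i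

/-- `K`: the largest number of arms that a feasible action in rounds `1, …, T` can trigger. -/
def maxTrig (P : Problem Act m) (D : ProbabilityMeasure (Fin m → ℝ)) (ctx : ℕ → Set Act)
    (T : ℕ) : ℕ :=
  sSup {k | ∃ t ∈ Finset.Icc 1 T, ∃ S ∈ ctx t, k = {i | 0 < P.trigProb D S i}.ncard}

end Problem

/-- Memory of the algorithm: the counters `T_i` and the empirical means `μ̂_i`. -/
abbrev State (m : ℕ) : Type := (Fin m → ℕ) × (Fin m → ℝ)

/-- Initially `T_i = 0` and `μ̂_i = 1`. -/
def initState (m : ℕ) : State m := (fun _ => 0, fun _ => 1)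

/-- The upper confidence bounds `min{μ̂_i + ρ_i, 1}` in round `t`, where
`ρ_i = √(3 ln t / (2 T_i))`, and `ρ_i = +∞` if `T_i = 0`. -/
def ucb (t : ℕ) (s : State m) : Fin m → ℝ := fun i =>
  if s.1 i = 0 then 1
  else min (s.2 i + Real.sqrt (3 * Real.log t / (2 * (s.1 i : ℝ)))) 1

open Classical in
/-- Update of the memory after the arms in `τ` have been triggered with outcomes `x i`. -/
def update (s : State m) (x : Fin m → ℝ) (τ : Set (Fin m)) : State m :=
  (fun i => if i ∈ τ then s.1 i + 1 else s.1 i,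
   fun i => if i ∈ τ then s.2 i + (x i - s.2 i) / ((s.1 i : ℝ) + 1) else s.2 i)

lemma measurable_ucb (t : ℕ) : Measurable (ucb t : State m → Fin m → ℝ) := by
  refine measurable_pi_lambda _ fun i => ?_
  unfold ucb
  have h1 : Measurable fun s : State m => s.1 i := (measurable_pi_apply i).comp measurable_fst
  have h2 : Measurable fun s : State m => s.2 i := (measurable_pi_apply i).comp measurable_snd
  have h3 : Measurable fun s : State m => ((s.1 i : ℕ) : ℝ) := (measurable_from_top).comp h1
  refine Measurable.ite (h1 (measurableSet_singleton 0)) measurable_const ?_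
  exact (h2.add ((measurable_const.div (measurable_const.mul h3)).sqrt)).min measurable_const

lemma measurableSet_mem_trig (i : Fin m) : MeasurableSet {τ : Set (Fin m) | i ∈ τ} :=
  measurableSet_setOfPred.2 (measurable_set_mem i)

lemma measurable_update :
    Measurable (fun z : State m × ((Fin m → ℝ) × Set (Fin m)) => update z.1 z.2.1 z.2.2) := by
  unfold update
  have hm (i : Fin m) : MeasurableSet
      {z : State m × ((Fin m → ℝ) × Set (Fin m)) | i ∈ z.2.2} :=
    (measurable_snd.comp measurable_snd) (measurableSet_mem_trig i)
  have h1 (i : Fin m) : Measurable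
      fun z : State m × ((Fin m → ℝ) × Set (Fin m)) => z.1.1 i :=
    (measurable_pi_apply i).comp (measurable_fst.comp measurable_fst)
  have h2 (i : Fin m) : Measurable
      fun z : State m × ((Fin m → ℝ) × Set (Fin m)) => z.1.2 i :=
    (measurable_pi_apply i).comp (measurable_snd.comp measurable_fst)
  have h3 (i : Fin m) : Measurable
      fun z : State m × ((Fin m → ℝ) × Set (Fin m)) => ((z.1.1 i : ℕ) : ℝ) :=
    (measurable_from_top).comp (h1 i)
  have h4 (i : Fin m) : Measurable
      fun z : State m × ((Fin m → ℝ) × Set (Fin m)) => z.2.1 i :=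
    (measurable_pi_apply i).comp (measurable_fst.comp measurable_snd)
  refine Measurable.prodMk ?_ ?_
  · refine measurable_pi_lambda _ fun i => ?_
    exact Measurable.ite (hm i) ((h1 i).add measurable_const) (h1 i)
  · refine measurable_pi_lambda _ fun i => ?_
    exact Measurable.ite (hm i)
      ((h2 i).add (((h4 i).sub (h2 i)).div ((h3 i).add measurable_const))) (h2 i)

/-- Law of the action `S^{(t)} ← O(ctx t, μ̄)` of round `t`, given the memory at its beginning. -/
def actionKernel (O : Set Act → Kernel (Fin m → ℝ) Act) (ctx : ℕ → Set Act) (t : ℕ) :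
    Kernel (State m) Act :=
  (O (ctx t)).comap (ucb t) (measurable_ucb t)

instance (O : Set Act → Kernel (Fin m → ℝ) Act) [∀ A, IsMarkovKernel (O A)] (ctx : ℕ → Set Act)
    (t : ℕ) : IsMarkovKernel (actionKernel O ctx t) := by
  unfold actionKernel; infer_instance

/-- Joint law of `(S^{(t)}, (X^{(t)}, τ_t))` given the memory at the beginning of round `t`. -/
def roundKernel (P : Problem Act m) (D : ProbabilityMeasure (Fin m → ℝ))
    (O : Set Act → Kernel (Fin m → ℝ) Act) (ctx : ℕ → Set Act) (t : ℕ) :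
    Kernel (State m) (Act × ((Fin m → ℝ) × Set (Fin m))) :=
  actionKernel O ctx t ⊗ₖ Kernel.prodMkLeft (State m) (outcomeKernel P.trig D)

instance (P : Problem Act m) (D : ProbabilityMeasure (Fin m → ℝ))
    (O : Set Act → Kernel (Fin m → ℝ) Act) [∀ A, IsMarkovKernel (O A)] (ctx : ℕ → Set Act)
    (t : ℕ) : IsMarkovKernel (roundKernel P D O ctx t) := by
  unfold roundKernel; infer_instance

/-- Law of the memory of the algorithm at the end of round `t` (`t = 0`: initially). -/
def stateLaw (P : Problem Act m) (D : ProbabilityMeasure (Fin m → ℝ))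
    (O : Set Act → Kernel (Fin m → ℝ) Act) (ctx : ℕ → Set Act) : ℕ → Measure (State m)
  | 0 => Measure.dirac (initState m)
  | t + 1 => (stateLaw P D O ctx t ⊗ₘ roundKernel P D O ctx (t + 1)).map
      (fun z => update z.1 z.2.2.1 z.2.2.2)

instance isProbabilityMeasure_stateLaw (P : Problem Act m) (D : ProbabilityMeasure (Fin m → ℝ))
    (O : Set Act → Kernel (Fin m → ℝ) Act) [∀ A, IsMarkovKernel (O A)] (ctx : ℕ → Set Act)
    (t : ℕ) : IsProbabilityMeasure (stateLaw P D O ctx t) := by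
  induction t with
  | zero => unfold stateLaw; infer_instance
  | succ t ih =>
    unfold stateLaw
    have h : Measurable (fun z : State m × (Act × ((Fin m → ℝ) × Set (Fin m))) =>
        update z.1 z.2.2.1 z.2.2.2) :=
      measurable_update.comp (measurable_fst.prodMk (measurable_snd.comp measurable_snd))
    exact Measure.isProbabilityMeasure_map h.aemeasurable

/-- Law of the action `S^{(t)}` played in round `t ≥ 1`. -/
def actionLaw (P : Problem Act m) (D : ProbabilityMeasure (Fin m → ℝ))
    (O : Set Act → Kernel (Fin m → ℝ) Act) (ctx : ℕ → Set Act) (t : ℕ) : Measure Act :=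
  (stateLaw P D O ctx (t - 1)).bind (actionKernel O ctx t)

/-- Expected `(α, β)`-approximation regret over `T` rounds of the contextual CUCB algorithm with
oracle `O`, on the sequence of contexts `ctx 1, …, ctx T`. -/
def regret (P : Problem Act m) (D : ProbabilityMeasure (Fin m → ℝ))
    (O : Set Act → Kernel (Fin m → ℝ) Act) (ctx : ℕ → Set Act) (α β : ℝ) (T : ℕ) : ℝ :=
  ∑ t ∈ Finset.Icc 1 T, α * β * P.opt (ctx t) (meanVec D)
    - ∑ t ∈ Finset.Icc 1 T, ∫ S, P.r S (meanVec D) ∂(actionLaw P D O ctx t)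

end C2MAB

end

noncomputable section

namespace C2MAB

open MeasureTheory ProbabilityTheory Set
open scoped ENNReal

variable {Act : Type*} [MeasurableSpace Act] {m : ℕ}

/-! ### Law of one outcome and its triggered set -/

section OutcomeLaw

variable (P : Problem Act m) {D : ProbabilityMeasure (Fin m → ℝ)}

/-! Optimism reduces regret to estimation error, and the estimation error of an arm is paid for by
the observations of that arm.

Concentration. Given the past, an outcome observed on triggering has mean `μ_i`, so by Hoeffding's
lemma `exp(l T_i (μ̂_i - μ_i) - l² T_i / 8)` has expectation at most 1 in every round
(`lintegral_stateLaw_exp_le_one`). A Chernoff bound for each value of the counter and a union bound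
over these values show that a given arm leaves its confidence interval on a given side with
probability at most `t/(t+1)^3` in round `t+1`. These probabilities sum to at most 1.

One round. If no arm deviates, every index exceeds its mean by at most `width T T_i`. Monotonicity
and smoothness then bound the gap of an action on which the oracle succeeds by `C ∑ p_i width T
T_i`. If some arm deviates, the round is charged to that arm, which costs `2 m Δ_max + C m` in total
(`gap_le_sum_of_approx_opt`). Oracle failures are absorbed by the factor `β` and by nonnegativity of
the rewards.

Summation. In each round arm `i` is triggered with conditional probability `p_i`, and its counter
then increases by one. Hence `∑_t E[p_i φ(T_i)] = E[∑_{k < T_i} φ k]` exactly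
(`sum_lintegral_trigProb_mul`). This identity handles the triggering probabilities without grouping
actions by their size. It remains to choose `φ` with bounded partial sums. The width minus a
threshold, cut off at zero, has partial sums at most `1 + 6 ln T / θ` (`sum_max_width_sub_le`). With
an arm-dependent threshold, the gap itself pays for what is subtracted, which gives (1). With a
common threshold, optimised at the end, one gets (2). Both bounds come out with smaller constants
than those claimed. -/

lemma measurableSet_cube (m : ℕ) : MeasurableSet (cube m) := by
  have : cube m = ⋂ i, {x : Fin m → ℝ | x i ∈ Icc (0 : ℝ) 1} := by
    ext x; simp [cube]
  rw [this]
  exact MeasurableSet.iInter fun i => (measurable_pi_apply i) measurableSet_Icc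

lemma ae_outcomeKernel_mem_cube (hD : D ∈ P.distClass) (S : Act) :
    ∀ᵐ y ∂(outcomeKernel P.trig D S), y.1 ∈ cube m := by
  unfold outcomeKernel
  refine Kernel.ae_compProd_of_ae_ae (measurable_fst (measurableSet_cube m)) ?_
  rw [Kernel.const_apply]
  filter_upwards [P.ae_mem_cube D hD] with x hx
  exact Filter.Eventually.of_forall fun _ => hx

lemma meanVec_mem_cube (hD : D ∈ P.distClass) : meanVec D ∈ cube m := by
  intro i
  have h := P.ae_mem_cube D hD
  have hint : Integrable (fun x : Fin m → ℝ => x i) (D : Measure (Fin m → ℝ)) :=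
    Integrable.of_mem_Icc 0 1 (measurable_pi_apply i).aemeasurable (h.mono fun x hx => hx i)
  constructor
  · exact integral_nonneg_of_ae (h.mono fun x hx => (hx i).1)
  · calc meanVec D i ≤ ∫ _, (1 : ℝ) ∂(D : Measure (Fin m → ℝ)) :=
          integral_mono_ae hint (integrable_const _) (h.mono fun x hx => (hx i).2)
      _ = 1 := by simp

lemma measurableSet_triggered (i : Fin m) :
    MeasurableSet {y : (Fin m → ℝ) × Set (Fin m) | i ∈ y.2} :=
  measurable_snd (measurableSet_mem_trig i)

lemma measurable_trigProb (D : ProbabilityMeasure (Fin m → ℝ)) (i : Fin m) :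
    Measurable fun S => P.trigProb D S i :=
  (Kernel.measurable_coe _ (measurableSet_triggered i)).ennreal_toReal

lemma trigProb_nonneg (D : ProbabilityMeasure (Fin m → ℝ)) (S : Act) (i : Fin m) :
    0 ≤ P.trigProb D S i := measureReal_nonneg

lemma trigProb_le_one (D : ProbabilityMeasure (Fin m → ℝ)) (S : Act) (i : Fin m) :
    P.trigProb D S i ≤ 1 := measureReal_le_one

lemma ofReal_trigProb (D : ProbabilityMeasure (Fin m → ℝ)) (S : Act) (i : Fin m) :
    ENNReal.ofReal (P.trigProb D S i) = outcomeKernel P.trig D S {y | i ∈ y.2} := by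
  unfold Problem.trigProb
  exact ofReal_measureReal

/-- Hoeffding's lemma for the centred outcome of an arm, conditionally on its being triggered. -/
lemma lintegral_exp_cond_triggered_le (hD : D ∈ P.distClass) (S : Act) (i : Fin m)
    (h0 : outcomeKernel P.trig D S {y | i ∈ y.2} ≠ 0) (l : ℝ) :
    ∫⁻ y, ENNReal.ofReal (Real.exp (l * (y.1 i - meanVec D i) - l ^ 2 / 8))
      ∂((outcomeKernel P.trig D S)[|{y | i ∈ y.2}]) ≤ 1 := by
  set ν := (outcomeKernel P.trig D S)[|{y | i ∈ y.2}] with hν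
  have : IsProbabilityMeasure ν := cond_isProbabilityMeasure h0
  have hmem : ∀ᵐ y ∂ν, y.1 i ∈ Icc (0 : ℝ) 1 := by
    have := ae_outcomeKernel_mem_cube P hD S
    filter_upwards [cond_absolutelyContinuous.ae_le this] with y hy using hy i
  have hmeas : Measurable fun y : (Fin m → ℝ) × Set (Fin m) => y.1 i :=
    (measurable_pi_apply i).comp measurable_fst
  have hsub := hasSubgaussianMGF_of_mem_Icc hmeas.aemeasurable hmem
  rw [P.mean_cond_trig D hD S i h0] at hsub
  have h1 := hsub.mgf_le l
  have h2 := hsub.integrable_exp_mul l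
  have h3 : ∀ y : (Fin m → ℝ) × Set (Fin m),
      Real.exp (l * (y.1 i - meanVec D i) - l ^ 2 / 8)
        = Real.exp (l * (y.1 i - meanVec D i)) * Real.exp (-(l ^ 2 / 8)) := by
    intro y; rw [← Real.exp_add]; ring_nf
  simp_rw [h3]
  rw [← ofReal_integral_eq_lintegral_ofReal (h2.mul_const _)
    (Filter.Eventually.of_forall fun y => by positivity), integral_mul_const]
  rw [← ENNReal.ofReal_one]
  apply ENNReal.ofReal_le_ofReal
  unfold mgf at h1
  -- A variable in an interval of length 1 is sub-Gaussian with variance proxy `1/4`, which gives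
  -- exactly the compensator `l ^ 2 / 8`.
  calc _ ≤ Real.exp (((‖(1 : ℝ) - 0‖₊ / 2) ^ 2 : NNReal) * l ^ 2 / 2) * Real.exp (-(l ^ 2 / 8)) := by
        gcongr
    _ = 1 := by
        rw [← Real.exp_add, Real.exp_eq_one_iff]
        simp
        ring

open Classical in
-- This is the multiplicative increment of the supermartingale over one round. Without a trigger the
-- memory of the arm does not change and the factor is 1. On the triggering event the conditional
-- Hoeffding bound gives at most the probability of that event.
lemma lintegral_exp_triggered_le (hD : D ∈ P.distClass) (S : Act) (i : Fin m) (l : ℝ) :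
    ∫⁻ y, (if i ∈ y.2 then
        ENNReal.ofReal (Real.exp (l * (y.1 i - meanVec D i) - l ^ 2 / 8)) else 1)
      ∂(outcomeKernel P.trig D S) ≤ 1 := by
  set ν := outcomeKernel P.trig D S
  set A := {y : (Fin m → ℝ) × Set (Fin m) | i ∈ y.2} with hA
  have hAm : MeasurableSet A := measurableSet_triggered i
  rw [← lintegral_add_compl _ hAm]
  have e1 : ∫⁻ y in A, (if i ∈ y.2 then
        ENNReal.ofReal (Real.exp (l * (y.1 i - meanVec D i) - l ^ 2 / 8)) else 1) ∂ν
      = ∫⁻ y in A, ENNReal.ofReal (Real.exp (l * (y.1 i - meanVec D i) - l ^ 2 / 8)) ∂ν :=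
    setLIntegral_congr_fun hAm fun y hy => if_pos hy
  have e2 : ∫⁻ y in Aᶜ, (if i ∈ y.2 then
        ENNReal.ofReal (Real.exp (l * (y.1 i - meanVec D i) - l ^ 2 / 8)) else 1) ∂ν
      = ν Aᶜ := by
    refine (setLIntegral_congr_fun (g := fun _ => 1) hAm.compl fun y hy => if_neg hy).trans ?_
    simp
  have e3 : ∫⁻ y in A, ENNReal.ofReal (Real.exp (l * (y.1 i - meanVec D i) - l ^ 2 / 8)) ∂ν
      ≤ ν A := by
    by_cases h0 : ν A = 0
    · rw [Measure.restrict_eq_zero.2 h0]; simp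
    · have h := lintegral_exp_cond_triggered_le P hD S i h0 l
      rw [ProbabilityTheory.cond, lintegral_smul_measure, smul_eq_mul,
        ENNReal.inv_mul_le_iff h0 (measure_ne_top _ _), mul_one] at h
      exact h
  rw [e1, e2]
  calc _ ≤ ν A + ν Aᶜ := by gcongr
    _ = 1 := prob_add_prob_compl hAm

end OutcomeLaw

/-! ### Evolution of the memory, concentration and counters -/

section StateLaw

variable (P : Problem Act m) (D : ProbabilityMeasure (Fin m → ℝ))
  (O : Set Act → Kernel (Fin m → ℝ) Act) [∀ A, IsMarkovKernel (O A)] (ctx : ℕ → Set Act)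

lemma measurable_update_snd (s : State m) :
    Measurable fun y : (Fin m → ℝ) × Set (Fin m) => update s y.1 y.2 :=
  measurable_update.comp (measurable_const.prodMk measurable_id)

/-- One-step Markov recursion: average over the memory, then over the oracle's action, then over the
outcome. The inductions over rounds rest on it. -/
lemma lintegral_stateLaw_succ (t : ℕ) {F : State m → ℝ≥0∞} (hF : Measurable F) :
    ∫⁻ s, F s ∂(stateLaw P D O ctx (t + 1))
      = ∫⁻ s, ∫⁻ S, ∫⁻ y, F (update s y.1 y.2) ∂(outcomeKernel P.trig D S)
          ∂(actionKernel O ctx (t + 1) s) ∂(stateLaw P D O ctx t) := by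
  have h : Measurable (fun z : State m × (Act × ((Fin m → ℝ) × Set (Fin m))) =>
      update z.1 z.2.2.1 z.2.2.2) :=
    measurable_update.comp (measurable_fst.prodMk (measurable_snd.comp measurable_snd))
  have hFh : Measurable (fun z : State m × (Act × ((Fin m → ℝ) × Set (Fin m))) =>
      F (update z.1 z.2.2.1 z.2.2.2)) := hF.comp h
  rw [stateLaw, lintegral_map hF h, Measure.lintegral_compProd hFh]
  refine lintegral_congr fun s => ?_
  have h' : Measurable (fun z : Act × ((Fin m → ℝ) × Set (Fin m)) =>
      F (update s z.2.1 z.2.2)) := hF.comp ((measurable_update_snd s).comp measurable_snd)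
  rw [roundKernel, Kernel.lintegral_compProd _ _ _ h']
  exact lintegral_congr fun S => Kernel.lintegral_prodMkLeft _ _
    (fun y : (Fin m → ℝ) × Set (Fin m) => F (update s y.1 y.2))

lemma ae_stateLaw_succ (t : ℕ) {p q : State m → Prop} (hq : MeasurableSet {s | q s})
    (hp : ∀ᵐ s ∂(stateLaw P D O ctx t), p s)
    (hpq : ∀ s, p s → ∀ S, ∀ᵐ y ∂(outcomeKernel P.trig D S), q (update s y.1 y.2)) :
    ∀ᵐ s ∂(stateLaw P D O ctx (t + 1)), q s := by
  rw [ae_iff, ← compl_ofPred, ← lintegral_indicator_one hq.compl,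
    lintegral_stateLaw_succ P D O ctx t (measurable_one.indicator hq.compl)]
  rw [lintegral_eq_zero_iff']
  · filter_upwards [hp] with s hs
    have : ∀ S, ∫⁻ y, ({s | q s}ᶜ).indicator (1 : State m → ℝ≥0∞) (update s y.1 y.2)
        ∂(outcomeKernel P.trig D S) = 0 := by
      intro S
      refine (lintegral_eq_zero_iff
        ((measurable_one.indicator hq.compl).comp (measurable_update_snd s))).2 ?_
      filter_upwards [hpq s hs S] with y hy
      simp [hy]
    simp [this]
  · refine Measurable.aemeasurable ?_
    refine Measurable.lintegral_kernel_prod_right' (κ := actionKernel O ctx (t + 1))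
      (f := fun z : State m × Act => ∫⁻ y, ({s | q s}ᶜ).indicator (1 : State m → ℝ≥0∞)
        (update z.1 y.1 y.2) ∂(outcomeKernel P.trig D z.2)) ?_
    refine Measurable.lintegral_kernel_prod_right'
      (κ := (Kernel.prodMkLeft (State m) (outcomeKernel P.trig D)))
      (f := fun z : (State m × Act) × ((Fin m → ℝ) × Set (Fin m)) =>
        ({s | q s}ᶜ).indicator (1 : State m → ℝ≥0∞) (update z.1.1 z.2.1 z.2.2)) ?_
    exact (measurable_one.indicator hq.compl).comp
      (measurable_update.comp ((measurable_fst.comp measurable_fst).prodMk measurable_snd))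

/-- The counters are at most the number of rounds, the empirical means are in `[0,1]`. -/
lemma ae_stateLaw_count_le_and_mem_cube (hD : D ∈ P.distClass) (t : ℕ) :
    ∀ᵐ s ∂(stateLaw P D O ctx t), (∀ i, s.1 i ≤ t) ∧ s.2 ∈ cube m := by
  have hmeas : ∀ t : ℕ, MeasurableSet {s : State m | (∀ i, s.1 i ≤ t) ∧ s.2 ∈ cube m} := by
    intro t
    refine MeasurableSet.inter ?_ (measurable_snd (measurableSet_cube m))
    have : {s : State m | ∀ i, s.1 i ≤ t} = ⋂ i, {s : State m | s.1 i ∈ Iic t} := by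
      ext; simp
    change MeasurableSet {s : State m | ∀ i, s.1 i ≤ t}
    rw [this]
    exact MeasurableSet.iInter fun i =>
      ((measurable_pi_apply i).comp measurable_fst) measurableSet_Iic
  induction t with
  | zero =>
    rw [stateLaw, ae_dirac_iff (hmeas 0)]
    exact ⟨fun i => le_rfl, fun i => by simp [initState]⟩
  | succ t ih =>
    refine ae_stateLaw_succ P D O ctx t (hmeas (t + 1)) ih ?_
    rintro s ⟨h1, h2⟩ S
    filter_upwards [ae_outcomeKernel_mem_cube P hD S] with y hy
    refine ⟨fun i => ?_, fun i => ?_⟩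
    · have := h1 i
      unfold update
      dsimp only
      split_ifs <;> omega
    · unfold update
      dsimp only
      split_ifs with hi
      · have hx := hy i
        have hs := h2 i
        have hn : (0 : ℝ) < (s.1 i : ℝ) + 1 := by positivity
        -- The updated mean is a convex combination of the old mean and the new outcome.
        have e : s.2 i + (y.1 i - s.2 i) / ((s.1 i : ℝ) + 1)
            = ((s.1 i : ℝ) * s.2 i + y.1 i) / ((s.1 i : ℝ) + 1) := by
          field_simp; ring
        rw [e]
        have hn0 : (0 : ℝ) ≤ (s.1 i : ℝ) := by positivity
        constructor
        · exact div_nonneg (add_nonneg (mul_nonneg hn0 hs.1) hx.1) hn.le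
        · rw [div_le_one hn]
          have := mul_le_mul_of_nonneg_left hs.2 hn0
          linarith [hx.2]
      · exact h2 i

/-- The exponential supermartingale of the centred sum of the observations of an arm. -/
lemma lintegral_stateLaw_exp_le_one (hD : D ∈ P.distClass) (i : Fin m) (l : ℝ) (t : ℕ) :
    ∫⁻ s, ENNReal.ofReal (Real.exp (l * ((s.1 i : ℝ) * (s.2 i - meanVec D i))
      - l ^ 2 / 8 * (s.1 i : ℝ))) ∂(stateLaw P D O ctx t) ≤ 1 := by
  have h1 : Measurable fun s : State m => s.1 i := (measurable_pi_apply i).comp measurable_fst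
  have h2 : Measurable fun s : State m => s.2 i := (measurable_pi_apply i).comp measurable_snd
  have h3 : Measurable fun s : State m => ((s.1 i : ℕ) : ℝ) := (measurable_from_top).comp h1
  have hF : Measurable fun s : State m => ENNReal.ofReal
      (Real.exp (l * ((s.1 i : ℝ) * (s.2 i - meanVec D i)) - l ^ 2 / 8 * (s.1 i : ℝ))) := by
    fun_prop
  induction t with
  | zero =>
    rw [stateLaw, lintegral_dirac' _ hF]
    simp [initState]
  | succ t ih =>
    rw [lintegral_stateLaw_succ P D O ctx t hF]
    refine le_trans (lintegral_mono fun s => ?_) ih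
    set Z := ENNReal.ofReal
      (Real.exp (l * ((s.1 i : ℝ) * (s.2 i - meanVec D i)) - l ^ 2 / 8 * (s.1 i : ℝ))) with hZ
    have key : ∀ S, ∫⁻ y, ENNReal.ofReal
        (Real.exp (l * (((update s y.1 y.2).1 i : ℝ) * ((update s y.1 y.2).2 i - meanVec D i))
          - l ^ 2 / 8 * ((update s y.1 y.2).1 i : ℝ))) ∂(outcomeKernel P.trig D S) ≤ Z := by
      intro S
      classical
      calc _ = ∫⁻ y, Z * (if i ∈ y.2 then
            ENNReal.ofReal (Real.exp (l * (y.1 i - meanVec D i) - l ^ 2 / 8)) else 1)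
            ∂(outcomeKernel P.trig D S) := by
            refine lintegral_congr fun y => ?_
            by_cases hi : i ∈ y.2
            -- A trigger adds exactly `y.1 i - meanVec D i` to the centred sum `T_i (μ̂_i - μ_i)`
            -- and 1 to the counter.
            · simp only [update, hi, if_true]
              rw [hZ, ← ENNReal.ofReal_mul (Real.exp_nonneg _), ← Real.exp_add]
              congr 2
              push_cast
              field_simp
              ring
            · simp [update, hi, hZ]
        _ ≤ Z * 1 := by
            rw [lintegral_const_mul' _ _ ENNReal.ofReal_ne_top]
            gcongr
            exact lintegral_exp_triggered_le P hD S i l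
        _ = Z := mul_one _
    calc _ ≤ ∫⁻ _, Z ∂(actionKernel O ctx (t + 1) s) := lintegral_mono fun S => key S
      _ = Z := by simp

/-- Confidence radius of an arm in round `t` after `n` observations. -/
def radius (t n : ℕ) : ℝ := Real.sqrt (3 * Real.log t / (2 * (n : ℝ)))

/-- The empirical mean of arm `i` misses `x` by more than the confidence radius of round `t`, from
above (`ε = 1`) or from below (`ε = -1`). -/
def deviates (t : ℕ) (x : ℝ) (i : Fin m) (ε : ℝ) : Set (State m) :=
  {s | s.1 i ≠ 0 ∧ radius t (s.1 i) < ε * (s.2 i - x)}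

lemma measurableSet_deviates (t : ℕ) (x : ℝ) (i : Fin m) (ε : ℝ) :
    MeasurableSet (deviates t x i ε) := by
  have h1 : Measurable fun s : State m => s.1 i := (measurable_pi_apply i).comp measurable_fst
  have h2 : Measurable fun s : State m => s.2 i := (measurable_pi_apply i).comp measurable_snd
  have h3 : Measurable fun s : State m => radius t (s.1 i) :=
    (measurable_from_top (f := radius t)).comp h1
  exact ((measurableSet_singleton 0).compl.preimage h1).inter
    (measurableSet_lt h3 (by fun_prop))

/-- Fixing the counter at `n` makes the radius `ρ` deterministic, so the Hoeffding-optimal parameter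
`l = 4ερ` is available. On the event the exponent is at least `4nρ² - 2nρ² = 2nρ² = 3 ln(t+1)`, and
Markov's inequality yields `(t+1)^(-3)`. -/
lemma stateLaw_count_eq_inter_deviates_le (hD : D ∈ P.distClass) (i : Fin m) {ε : ℝ}
    (hε : ε ^ 2 = 1) (t n : ℕ) (hn : n ≠ 0) :
    stateLaw P D O ctx t {s | s.1 i = n ∧ s ∈ deviates (t + 1) (meanVec D i) i ε}
      ≤ ENNReal.ofReal (1 / ((t : ℝ) + 1) ^ 3) := by
  set ρ := radius (t + 1) n with hρ
  have hρ0 : 0 ≤ ρ := Real.sqrt_nonneg _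
  have hn' : (0 : ℝ) < n := by positivity
  have hlog : 0 ≤ Real.log ((t + 1 : ℕ) : ℝ) := Real.log_natCast_nonneg _
  have hρ2 : 2 * n * ρ ^ 2 = 3 * Real.log ((t + 1 : ℕ) : ℝ) := by
    rw [hρ, radius, Real.sq_sqrt (by positivity)]
    field_simp
  have hsub : {s : State m | s.1 i = n ∧ s ∈ deviates (t + 1) (meanVec D i) i ε} ⊆
      {s | ENNReal.ofReal (((t : ℝ) + 1) ^ 3) ≤ ENNReal.ofReal
        (Real.exp ((4 * ε * ρ) * ((s.1 i : ℝ) * (s.2 i - meanVec D i))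
          - (4 * ε * ρ) ^ 2 / 8 * (s.1 i : ℝ)))} := by
    rintro s ⟨h1, -, h2⟩
    rw [h1, ← hρ] at h2
    apply ENNReal.ofReal_le_ofReal
    have e : ((t : ℝ) + 1) ^ 3 = Real.exp (3 * Real.log ((t + 1 : ℕ) : ℝ)) := by
      rw [mul_comm, Real.exp_mul, Real.exp_log (by positivity)]
      push_cast
      norm_cast
    rw [e, h1]
    apply Real.exp_le_exp.2
    rw [← hρ2]
    have e2 : (4 * ε * ρ) * ((n : ℝ) * (s.2 i - meanVec D i)) - (4 * ε * ρ) ^ 2 / 8 * (n : ℝ)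
        = 4 * n * ρ * (ε * (s.2 i - meanVec D i)) - 2 * n * ρ ^ 2 * ε ^ 2 := by ring
    rw [e2, hε]
    have : 4 * n * ρ * ρ ≤ 4 * n * ρ * (ε * (s.2 i - meanVec D i)) := by gcongr
    nlinarith
  have h1 : Measurable fun s : State m => s.1 i := (measurable_pi_apply i).comp measurable_fst
  have h2 : Measurable fun s : State m => s.2 i := (measurable_pi_apply i).comp measurable_snd
  have h3 : Measurable fun s : State m => ((s.1 i : ℕ) : ℝ) := (measurable_from_top).comp h1
  refine (measure_mono hsub).trans ?_
  have hpos : (0 : ℝ) < ((t : ℝ) + 1) ^ 3 := by positivity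
  refine (meas_ge_le_lintegral_div (by fun_prop) (ENNReal.ofReal_pos.2 hpos).ne'
    ENNReal.ofReal_ne_top).trans ?_
  calc _ ≤ 1 / ENNReal.ofReal (((t : ℝ) + 1) ^ 3) := by
        gcongr
        exact lintegral_stateLaw_exp_le_one P D O ctx hD i _ t
    _ = _ := by
        rw [ENNReal.ofReal_div_of_pos hpos, ENNReal.ofReal_one]

/-- Union bound over the possible counters. The memory after `t` rounds feeds round `t + 1`, so the
radius is taken at `t + 1` while a nonzero counter has only `t` possible values. -/
lemma stateLaw_deviates_le (hD : D ∈ P.distClass) (i : Fin m) {ε : ℝ} (hε : ε ^ 2 = 1) (t : ℕ) :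
    stateLaw P D O ctx t (deviates (t + 1) (meanVec D i) i ε)
      ≤ ENNReal.ofReal (t / ((t : ℝ) + 1) ^ 3) := by
  have h : stateLaw P D O ctx t (deviates (t + 1) (meanVec D i) i ε) ≤
      stateLaw P D O ctx t (⋃ n ∈ Finset.Icc 1 t,
        {s | s.1 i = n ∧ s ∈ deviates (t + 1) (meanVec D i) i ε}) := by
    refine measure_mono_ae ?_
    filter_upwards [ae_stateLaw_count_le_and_mem_cube P D O ctx hD t] with s hs hdev
    have h0 : s.1 i ≠ 0 := hdev.1
    have : s ∈ ⋃ n ∈ Finset.Icc 1 t,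
        {s | s.1 i = n ∧ s ∈ deviates (t + 1) (meanVec D i) i ε} := by
      simp only [mem_iUnion, mem_ofPred_eq]
      exact ⟨s.1 i, Finset.mem_Icc.2 ⟨by omega, hs.1 i⟩, rfl, hdev⟩
    exact this
  refine h.trans ((measure_biUnion_finset_le _ _).trans ?_)
  calc _ ≤ ∑ n ∈ Finset.Icc 1 t, ENNReal.ofReal (1 / ((t : ℝ) + 1) ^ 3) :=
        Finset.sum_le_sum fun n hn => stateLaw_count_eq_inter_deviates_le P D O ctx hD i hε t n
          (by have := (Finset.mem_Icc.1 hn).1; omega)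
    _ = _ := by
        rw [Finset.sum_const, Nat.card_Icc, nsmul_eq_mul, Nat.add_sub_cancel,
          ← ENNReal.ofReal_natCast, ← ENNReal.ofReal_mul (by positivity)]
        congr 1
        ring

lemma sum_div_add_one_pow_three_le (T : ℕ) :
    ∑ t ∈ Finset.range T, (t : ℝ) / ((t : ℝ) + 1) ^ 3 ≤ 1 := by
  have h : ∀ T : ℕ, ∑ t ∈ Finset.range T, (t : ℝ) / ((t : ℝ) + 1) ^ 3
      ≤ 1 - 1 / ((T : ℝ) + 1) := by
    intro T
    induction T with
    | zero => simp
    | succ T ih =>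
      rw [Finset.sum_range_succ]
      -- Telescoping majorant; it amounts to `T (T + 2) ≤ (T + 1) ^ 2`.
      have : (T : ℝ) / ((T : ℝ) + 1) ^ 3 ≤ 1 / ((T : ℝ) + 1) - 1 / ((T : ℝ) + 1 + 1) := by
        rw [div_sub_div _ _ (by positivity) (by positivity), div_le_div_iff₀ (by positivity)
          (by positivity)]
        have hT : (0 : ℝ) ≤ T := by positivity
        nlinarith [pow_nonneg hT 2, pow_nonneg hT 3, mul_nonneg hT hT]
      push_cast
      linarith
  refine (h T).trans ?_
  have : (0 : ℝ) ≤ 1 / ((T : ℝ) + 1) := by positivity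
  linarith

lemma sum_stateLaw_deviates_le_one (hD : D ∈ P.distClass) (i : Fin m) {ε : ℝ} (hε : ε ^ 2 = 1)
    (T : ℕ) :
    ∑ t ∈ Finset.range T, stateLaw P D O ctx t (deviates (t + 1) (meanVec D i) i ε) ≤ 1 := by
  calc _ ≤ ∑ t ∈ Finset.range T, ENNReal.ofReal (t / ((t : ℝ) + 1) ^ 3) :=
        Finset.sum_le_sum fun t _ => stateLaw_deviates_le P D O ctx hD i hε t
    _ = ENNReal.ofReal (∑ t ∈ Finset.range T, (t : ℝ) / ((t : ℝ) + 1) ^ 3) :=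
        (ENNReal.ofReal_sum_of_nonneg fun t _ => by positivity).symm
    _ ≤ 1 := by
        rw [← ENNReal.ofReal_one]
        exact ENNReal.ofReal_le_ofReal (sum_div_add_one_pow_three_le T)

/-- The sum over the rounds of the expected triggering probability of an arm, weighted by a
function of its counter, telescopes. -/
lemma sum_lintegral_trigProb_mul (i : Fin m) (φ : ℕ → ℝ≥0∞) (T : ℕ) :
    ∑ t ∈ Finset.range T, ∫⁻ s, ∫⁻ S, ENNReal.ofReal (P.trigProb D S i) * φ (s.1 i)
        ∂(actionKernel O ctx (t + 1) s) ∂(stateLaw P D O ctx t)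
      = ∫⁻ s, ∑ k ∈ Finset.range (s.1 i), φ k ∂(stateLaw P D O ctx T) := by
  have h1 : Measurable fun s : State m => s.1 i := (measurable_pi_apply i).comp measurable_fst
  have hF : Measurable fun s : State m => ∑ k ∈ Finset.range (s.1 i), φ k :=
    (measurable_from_top (f := fun n : ℕ => ∑ k ∈ Finset.range n, φ k)).comp h1
  induction T with
  | zero =>
    rw [stateLaw, lintegral_dirac' _ hF]
    simp [initState]
  | succ T ih =>
    rw [Finset.sum_range_succ, ih, lintegral_stateLaw_succ P D O ctx T hF,
      ← lintegral_add_left hF]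
    refine lintegral_congr fun s => ?_
    classical
    -- A trigger extends the sum by the single term at the current counter, and this happens with
    -- probability `trigProb`.
    have key : ∀ S, ∫⁻ y, ∑ k ∈ Finset.range ((update s y.1 y.2).1 i), φ k
        ∂(outcomeKernel P.trig D S)
        = ∑ k ∈ Finset.range (s.1 i), φ k
          + ENNReal.ofReal (P.trigProb D S i) * φ (s.1 i) := by
      intro S
      calc _ = ∫⁻ y, (∑ k ∈ Finset.range (s.1 i), φ k
              + {y : (Fin m → ℝ) × Set (Fin m) | i ∈ y.2}.indicator (fun _ => φ (s.1 i)) y)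
            ∂(outcomeKernel P.trig D S) := by
            refine lintegral_congr fun y => ?_
            by_cases hi : i ∈ y.2
            · simp [update, hi, Finset.sum_range_succ]
            · simp [update, hi]
        _ = _ := by
            rw [lintegral_add_left measurable_const, lintegral_const,
              lintegral_indicator_const (measurableSet_triggered i), measure_univ, mul_one,
              ofReal_trigProb, mul_comm]
    simp_rw [key]
    rw [lintegral_add_left measurable_const, lintegral_const, measure_univ, mul_one]

end StateLaw

/-! ### Gaps, optimal values and the smoothness conditions -/

section Gap

variable (P : Problem Act m) {D : ProbabilityMeasure (Fin m → ℝ)} {C α β : ℝ}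

lemma Problem.gap_nonneg (A : Set Act) (S : Act) : 0 ≤ P.gap α D A S := le_max_left _ _

lemma Problem.TPM.abs_sub_le_sum (hTPM : P.TPM C) (hC : 0 < C) (hD : D ∈ P.distClass) (S : Act)
    {μ' : Fin m → ℝ} (hμ' : μ' ∈ cube m) :
    |P.r S (meanVec D) - P.r S μ'| ≤ C * ∑ i, |meanVec D i - μ' i| := by
  refine (hTPM D hD μ' hμ' S).trans ?_
  gcongr with i
  exact mul_le_of_le_one_left (abs_nonneg _) (trigProb_le_one P D S i)

lemma opt_nonneg (hnonneg : ∀ S : Act, 0 ≤ P.r S (meanVec D)) (A : Set Act) :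
    0 ≤ P.opt A (meanVec D) := by
  refine Real.sSup_nonneg ?_
  rintro _ ⟨S, -, rfl⟩
  exact hnonneg S

/-- The optimal value can only drop through the coordinates that are underestimated. -/
lemma opt_le_opt_add (hC : 0 < C) (hmono : P.Monotonicity) (hTPM : P.TPM C)
    (hD : D ∈ P.distClass) {A : Set Act} (hA : A.Nonempty)
    (hbdd : BddAbove ((fun S => P.r S (meanVec D)) '' A)) {μ' : Fin m → ℝ} (hμ' : μ' ∈ cube m) :
    P.opt A (meanVec D) ≤ P.opt A μ' + C * ∑ i, max 0 (meanVec D i - μ' i) := by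
  have hμ := meanVec_mem_cube P hD
  -- `sSup` of an unbounded set of reals is 0 by default, so finiteness of the optimum has to be
  -- carried over from the true mean to `μ'`.
  have hbdd' : BddAbove ((fun S => P.r S μ') '' A) := by
    obtain ⟨b, hb⟩ := hbdd
    refine ⟨b + C * ∑ i, |meanVec D i - μ' i|, ?_⟩
    rintro _ ⟨S, hS, rfl⟩
    have h1 := hb (mem_image_of_mem _ hS)
    have h2 := abs_le.1 (hTPM.abs_sub_le_sum P hC hD S hμ')
    dsimp only at h1 ⊢
    linarith [h2.1]
  refine csSup_le (hA.image _) ?_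
  rintro _ ⟨S, hS, rfl⟩
  -- The coordinatewise minimum lies below `μ'`, so monotonicity applies to it, and it differs from
  -- the true mean only where `μ'` underestimates, so smoothness charges only those coordinates.
  have hinf : (fun i => min (meanVec D i) (μ' i)) ∈ cube m := fun i =>
    ⟨le_min (hμ i).1 (hμ' i).1, min_le_of_left_le (hμ i).2⟩
  have h1 := abs_le.1 (hTPM.abs_sub_le_sum P hC hD S hinf)
  have h2 := hmono S _ hinf μ' hμ' fun i => min_le_right _ _
  have h3 : P.r S μ' ≤ P.opt A μ' := le_csSup hbdd' (mem_image_of_mem _ hS)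
  have h4 : ∀ i, |meanVec D i - min (meanVec D i) (μ' i)| = max 0 (meanVec D i - μ' i) := by
    intro i
    rcases le_total (meanVec D i) (μ' i) with h | h
    · rw [min_eq_left h, max_eq_left (by linarith)]; simp
    · rw [min_eq_right h, max_eq_right (by linarith), abs_of_nonneg (by linarith)]
  simp_rw [h4] at h1
  dsimp only
  linarith [h1.2]

/-- The gap of an action that is approximately optimal for `μ'`. -/
lemma gap_le_of_approx_opt (hC : 0 < C) (hmono : P.Monotonicity) (hTPM : P.TPM C)
    (hD : D ∈ P.distClass) (hα0 : 0 ≤ α) (hα1 : α ≤ 1) {A : Set Act} (hA : A.Nonempty)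
    (hbdd : BddAbove ((fun S => P.r S (meanVec D)) '' A)) {μ' : Fin m → ℝ} (hμ' : μ' ∈ cube m)
    {S : Act} (hS : α * P.opt A μ' ≤ P.r S μ') :
    P.gap α D A S ≤ C * ∑ i, P.trigProb D S i * |meanVec D i - μ' i|
      + C * ∑ i, max 0 (meanVec D i - μ' i) := by
  have h1 := opt_le_opt_add P hC hmono hTPM hD hA hbdd hμ'
  have h2 := abs_le.1 (hTPM D hD μ' hμ' S)
  have hs : 0 ≤ C * ∑ i, max 0 (meanVec D i - μ' i) :=
    mul_nonneg hC.le (Finset.sum_nonneg fun i _ => le_max_left _ _)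
  have hp : 0 ≤ C * ∑ i, P.trigProb D S i * |meanVec D i - μ' i| :=
    mul_nonneg hC.le (Finset.sum_nonneg fun i _ =>
      mul_nonneg (trigProb_nonneg P D S i) (abs_nonneg _))
  refine max_le (by positivity) ?_
  have h3 := mul_le_mul_of_nonneg_left h1 hα0
  have h4 : α * (C * ∑ i, max 0 (meanVec D i - μ' i)) ≤ C * ∑ i, max 0 (meanVec D i - μ' i) :=
    mul_le_of_le_one_left hs hα1
  rw [mul_add] at h3
  linarith [h2.1]

lemma gap_le_opt (hnonneg : ∀ S : Act, 0 ≤ P.r S (meanVec D)) (hα1 : α ≤ 1)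
    (A : Set Act) (S : Act) : P.gap α D A S ≤ P.opt A (meanVec D) := by
  have h0 := opt_nonneg P hnonneg A
  refine max_le h0 ?_
  have := mul_le_of_le_one_left h0 hα1
  linarith [hnonneg S]

variable (ctx : ℕ → Set Act) {T t : ℕ}

/-- Nonnegative rewards bound each gap by the optimum of its context, and only finitely many
contexts occur up to `T`. Without finiteness `toReal` would turn `Δ_max` into 0. -/
lemma gapMax_ne_top (hnonneg : ∀ S : Act, 0 ≤ P.r S (meanVec D)) (hα1 : α ≤ 1) :
    P.gapMax α D ctx T ≠ ∞ := by
  refine ne_top_of_le_ne_top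
    (ENNReal.ofReal_ne_top (r := ∑ t ∈ Finset.Icc 1 T, P.opt (ctx t) (meanVec D))) ?_
  refine iSup_le fun i => iSup₂_le fun t ht => iSup₂_le fun S _ => iSup_le fun _ =>
    iSup_le fun _ => ENNReal.ofReal_le_ofReal ?_
  exact (gap_le_opt P hnonneg hα1 _ _).trans (Finset.single_le_sum
    (f := fun t => P.opt (ctx t) (meanVec D)) (fun t _ => opt_nonneg P hnonneg (ctx t)) ht)

lemma gap_le_gapMax (hnonneg : ∀ S : Act, 0 ≤ P.r S (meanVec D)) (hα1 : α ≤ 1)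
    (ht : t ∈ Finset.Icc 1 T) {S : Act} (hS : S ∈ ctx t) {i : Fin m}
    (hi : 0 < P.trigProb D S i) : P.gap α D (ctx t) S ≤ (P.gapMax α D ctx T).toReal := by
  rcases (P.gap_nonneg (ctx t) S).eq_or_lt with h | h
  · rw [← h]; exact ENNReal.toReal_nonneg
  · rw [← ENNReal.ofReal_le_iff_le_toReal (gapMax_ne_top P ctx hnonneg hα1)]
    refine le_trans ?_ (le_iSup _ i)
    exact le_iSup₂_of_le t ht (le_iSup₂_of_le S hS (le_iSup₂_of_le hi h le_rfl))

lemma gapMinArm_le_gap (ht : t ∈ Finset.Icc 1 T) {S : Act} (hS : S ∈ ctx t) {i : Fin m}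
    (hi : 0 < P.trigProb D S i) (h : 0 < P.gap α D (ctx t) S) :
    P.gapMinArm α D ctx T i ≤ ENNReal.ofReal (P.gap α D (ctx t) S) :=
  iInf₂_le_of_le t ht (iInf₂_le_of_le S hS (iInf₂_le_of_le hi h le_rfl))

lemma ncard_triggerable_le_maxTrig (ht : t ∈ Finset.Icc 1 T) {S : Act} (hS : S ∈ ctx t) :
    {i | 0 < P.trigProb D S i}.ncard ≤ P.maxTrig D ctx T := by
  -- The bound `m` makes the supremum in `ℕ` genuine; for an unbounded set it would be 0.
  refine le_csSup ⟨m, ?_⟩ ⟨t, ht, S, hS, rfl⟩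
  rintro _ ⟨t, -, S, -, rfl⟩
  calc _ ≤ (univ : Set (Fin m)).ncard := ncard_le_ncard (subset_univ _)
    _ = m := by simp [ncard_univ]

end Gap

/-! ### The gap of a single round -/

section RoundRegret

variable (P : Problem Act m) {D : ProbabilityMeasure (Fin m → ℝ)} {C α β : ℝ}

lemma ucb_mem_cube (t : ℕ) {s : State m} (hs : s.2 ∈ cube m) : ucb t s ∈ cube m := by
  intro i
  unfold ucb
  split_ifs
  · simp
  · exact ⟨le_min (add_nonneg (hs i).1 (Real.sqrt_nonneg _)) zero_le_one, min_le_right _ _⟩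

/-- Width of the confidence interval of an arm with `n` observations, at horizon `T`. -/
def width (T n : ℕ) : ℝ := if n = 0 then 1 else Real.sqrt (6 * Real.log T / n)

/-- The index of a non-deviating arm exceeds its mean by at most two radii. Replacing `ln t` by `ln
T` makes the bound a function of the counter alone, as the telescoping identity requires. -/
lemma two_mul_radius_le_width {t T n : ℕ} (ht : t ∈ Finset.Icc 1 T) (hn : n ≠ 0) :
    2 * radius t n ≤ width T n := by
  rw [width, if_neg hn, radius]
  have h2 : (2 : ℝ) = Real.sqrt 4 := by
    rw [show (4 : ℝ) = 2 ^ 2 by norm_num, Real.sqrt_sq (by norm_num)]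
  obtain ⟨h1, hT⟩ := Finset.mem_Icc.1 ht
  have hlog : Real.log t ≤ Real.log T :=
    Real.log_le_log (by exact_mod_cast h1) (by exact_mod_cast hT)
  have hn' : (0 : ℝ) < n := by positivity
  have h4 : 2 * Real.sqrt (3 * Real.log t / (2 * (n : ℝ)))
      = Real.sqrt (4 * (3 * Real.log t / (2 * (n : ℝ)))) := by
    rw [Real.sqrt_mul (by norm_num), ← h2]
  rw [h4]
  apply Real.sqrt_le_sqrt
  calc 4 * (3 * Real.log t / (2 * (n : ℝ))) = 6 * Real.log t / n := by field_simp; ring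
    _ ≤ _ := by gcongr

lemma meanVec_sub_ucb_nonpos (hD : D ∈ P.distClass) {t : ℕ} {s : State m} {i : Fin m}
    (hlow : s ∉ deviates t (meanVec D i) i (-1)) : meanVec D i - ucb t s i ≤ 0 := by
  have hμ := (meanVec_mem_cube P hD i).2
  by_cases h0 : s.1 i = 0
  · simp only [ucb, h0, if_true]; linarith
  · have h : ¬ radius t (s.1 i) < -1 * (s.2 i - meanVec D i) := fun h => hlow ⟨h0, h⟩
    simp only [ucb, h0, if_false]
    rw [sub_nonpos]
    refine le_min ?_ hμ
    change meanVec D i ≤ s.2 i + radius t (s.1 i)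
    linarith

lemma abs_meanVec_sub_ucb_le (hD : D ∈ P.distClass) {t T : ℕ} (ht : t ∈ Finset.Icc 1 T)
    {s : State m} {i : Fin m} (hlow : s ∉ deviates t (meanVec D i) i (-1))
    (hhigh : s ∉ deviates t (meanVec D i) i 1) :
    |meanVec D i - ucb t s i| ≤ width T (s.1 i) := by
  rw [abs_of_nonpos (meanVec_sub_ucb_nonpos P hD hlow)]
  by_cases h0 : s.1 i = 0
  · simp only [ucb, h0, if_true, width]
    linarith [(meanVec_mem_cube P hD i).1]
  · have h : ¬ radius t (s.1 i) < 1 * (s.2 i - meanVec D i) := fun h => hhigh ⟨h0, h⟩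
    refine le_trans ?_ (two_mul_radius_le_width ht h0)
    have h2 : ucb t s i ≤ s.2 i + radius t (s.1 i) := by
      simp only [ucb, h0, if_false]
      exact min_le_left _ _
    linarith

/-- The gap of an action on which the oracle succeeds, in a given state of the algorithm. -/
lemma gap_le_sum_of_approx_opt (hC : 0 < C) (hmono : P.Monotonicity) (hTPM : P.TPM C)
    (hD : D ∈ P.distClass) (hnonneg : ∀ S : Act, 0 ≤ P.r S (meanVec D))
    (hα0 : 0 ≤ α) (hα1 : α ≤ 1) (ctx : ℕ → Set Act)
    (hopt : ∀ t, BddAbove ((fun S => P.r S (meanVec D)) '' ctx t)) {t T : ℕ}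
    (ht : t ∈ Finset.Icc 1 T) {s : State m} (hs : s.2 ∈ cube m) {S : Act} (hS : S ∈ ctx t)
    (happ : α * P.opt (ctx t) (ucb t s) ≤ P.r S (ucb t s))
    (φ : Fin m → ℕ → ℝ) (hφ0 : ∀ i n, 0 ≤ φ i n) {c : ℝ} (hc : 0 ≤ c)
    (hφ : ∀ n : Fin m → ℕ, P.gap α D (ctx t) S ≤ C * ∑ i, P.trigProb D S i * width T (n i) →
      P.gap α D (ctx t) S ≤ ∑ i, P.trigProb D S i * φ i (n i) + c) :
    P.gap α D (ctx t) S ≤ ∑ i, (P.trigProb D S i * φ i (s.1 i)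
      + ((deviates t (meanVec D i) i (-1)).indicator
          (fun _ => (P.gapMax α D ctx T).toReal + C) s
        + (deviates t (meanVec D i) i 1).indicator
          (fun _ => (P.gapMax α D ctx T).toReal) s)) + c := by
  set d := (P.gapMax α D ctx T).toReal with hd
  have hd0 : 0 ≤ d := ENNReal.toReal_nonneg
  have hu := ucb_mem_cube t hs
  have hgap := gap_le_of_approx_opt P hC hmono hTPM hD hα0 hα1 ⟨S, hS⟩ (hopt t) hu happ
  have hlow0 : ∀ i, 0 ≤ (deviates t (meanVec D i) i (-1)).indicator (fun _ => d + C) s :=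
    fun i => indicator_nonneg (fun _ _ => by positivity) _
  have hhigh0 : ∀ i, 0 ≤ (deviates t (meanVec D i) i 1).indicator (fun _ => d) s :=
    fun i => indicator_nonneg (fun _ _ => hd0) _
  have hpφ : ∀ i, 0 ≤ P.trigProb D S i * φ i (s.1 i) :=
    fun i => mul_nonneg (trigProb_nonneg P D S i) (hφ0 i _)
  by_cases hnice : ∀ i, s ∉ deviates t (meanVec D i) i (-1) ∧ s ∉ deviates t (meanVec D i) i 1
  · have h1 : P.gap α D (ctx t) S ≤ C * ∑ i, P.trigProb D S i * width T (s.1 i) := by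
      refine hgap.trans ?_
      have h0 : ∑ i, max 0 (meanVec D i - ucb t s i) = 0 :=
        Finset.sum_eq_zero fun i _ => max_eq_left (meanVec_sub_ucb_nonpos P hD (hnice i).1)
      rw [h0, mul_zero, add_zero]
      gcongr with i
      · exact trigProb_nonneg P D S i
      · exact abs_meanVec_sub_ucb_le P hD ht (hnice i).1 (hnice i).2
    refine (hφ s.1 h1).trans ?_
    gcongr with i
    linarith [hlow0 i, hhigh0 i]
  -- Some arm deviates. If the action can trigger an arm, its gap is at most `Δ_max`, and the
  -- deviating arm pays for it.
  · by_cases htrig : ∃ i, 0 < P.trigProb D S i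
    · obtain ⟨j, hj⟩ := htrig
      have hgd : P.gap α D (ctx t) S ≤ d := gap_le_gapMax P ctx hnonneg hα1 ht hS hj
      push Not at hnice
      obtain ⟨i, hi⟩ := hnice
      have hi' : d ≤ P.trigProb D S i * φ i (s.1 i)
          + ((deviates t (meanVec D i) i (-1)).indicator (fun _ => d + C) s
            + (deviates t (meanVec D i) i 1).indicator (fun _ => d) s) := by
        by_cases hl : s ∈ deviates t (meanVec D i) i (-1)
        · rw [indicator_of_mem hl]
          linarith [hpφ i, hhigh0 i]
        · rw [indicator_of_mem (hi hl)]
          linarith [hpφ i, hlow0 i]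
      have := Finset.single_le_sum (f := fun i => P.trigProb D S i * φ i (s.1 i)
          + ((deviates t (meanVec D i) i (-1)).indicator (fun _ => d + C) s
            + (deviates t (meanVec D i) i 1).indicator (fun _ => d) s))
        (fun i _ => add_nonneg (hpφ i) (add_nonneg (hlow0 i) (hhigh0 i))) (Finset.mem_univ i)
      linarith
    -- An action that triggers nothing is invisible to `Δ_max`. Its smoothness error vanishes, so
    -- its gap comes only from the drop of the optimum, at most `C` for each underestimated arm.
    -- This is why `C` is added on the lower deviation only.
    · push Not at htrig
      have h0 : ∀ i, P.trigProb D S i = 0 :=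
        fun i => le_antisymm (htrig i) (trigProb_nonneg P D S i)
      simp only [h0, zero_mul, Finset.sum_const_zero, mul_zero, zero_add] at hgap ⊢
      refine hgap.trans ?_
      rw [Finset.mul_sum]
      refine le_add_of_le_of_nonneg (Finset.sum_le_sum fun i _ => ?_) hc
      refine le_add_of_le_of_nonneg ?_ (hhigh0 i)
      by_cases hl : s ∈ deviates t (meanVec D i) i (-1)
      · rw [indicator_of_mem hl]
        have : max 0 (meanVec D i - ucb t s i) ≤ 1 :=
          max_le zero_le_one (by linarith [(meanVec_mem_cube P hD i).2, (hu i).1])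
        nlinarith
      · rw [max_eq_left (meanVec_sub_ucb_nonpos P hD hl), mul_zero]
        exact hlow0 i

end RoundRegret

/-! ### From gaps to regret -/

section Regret

variable (P : Problem Act m) {D : ProbabilityMeasure (Fin m → ℝ)} {C α β : ℝ}
  (O : Set Act → Kernel (Fin m → ℝ) Act) (ctx : ℕ → Set Act)

lemma lintegral_actionLaw (D : ProbabilityMeasure (Fin m → ℝ)) (t : ℕ) {f : Act → ℝ≥0∞}
    (hf : Measurable f) :
    ∫⁻ S, f S ∂(actionLaw P D O ctx (t + 1))
      = ∫⁻ s, ∫⁻ S, f S ∂(actionKernel O ctx (t + 1) s) ∂(stateLaw P D O ctx t) :=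
  Measure.lintegral_bind (Kernel.measurable _).aemeasurable hf.aemeasurable

variable [∀ A, IsMarkovKernel (O A)]

lemma measurable_actionKernel_lintegral (t : ℕ) {f : State m × Act → ℝ≥0∞} (hf : Measurable f) :
    Measurable fun s => ∫⁻ S, f (s, S) ∂(actionKernel O ctx t s) :=
  Measurable.lintegral_kernel_prod_right' (κ := actionKernel O ctx t) hf

/-- One-round regret bound: it suffices to control the gap when the oracle succeeds. -/
lemma ofReal_mul_opt_le (hD : D ∈ P.distClass)
    (hnonneg : ∀ S : Act, 0 ≤ P.r S (meanVec D)) (hα0 : 0 ≤ α)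
    (hO : ∀ t, P.IsApproxOracle α β O (ctx t)) (t : ℕ) {g : State m × Act → ℝ≥0∞}
    (hgap : ∀ s : State m, s.2 ∈ cube m → ∀ S ∈ ctx (t + 1),
      α * P.opt (ctx (t + 1)) (ucb (t + 1) s) ≤ P.r S (ucb (t + 1) s) →
      ENNReal.ofReal (P.gap α D (ctx (t + 1)) S) ≤ g (s, S)) :
    ENNReal.ofReal (α * β * P.opt (ctx (t + 1)) (meanVec D))
      ≤ ∫⁻ S, ENNReal.ofReal (P.r S (meanVec D)) ∂(actionLaw P D O ctx (t + 1))
        + ∫⁻ s, ∫⁻ S, g (s, S) ∂(actionKernel O ctx (t + 1) s) ∂(stateLaw P D O ctx t) := by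
  have hr : Measurable fun S => ENNReal.ofReal (P.r S (meanVec D)) :=
    (P.measurable_r _ (meanVec_mem_cube P hD)).ennreal_ofReal
  have hr' : Measurable fun z : State m × Act => ENNReal.ofReal (P.r z.2 (meanVec D)) :=
    hr.comp measurable_snd
  set o := P.opt (ctx (t + 1)) (meanVec D) with ho
  rw [lintegral_actionLaw P O ctx D t hr,
    ← lintegral_add_left (measurable_actionKernel_lintegral O ctx (t + 1) hr')]
  have hae : ∀ᵐ s ∂(stateLaw P D O ctx t), ENNReal.ofReal (α * β * o)
      ≤ ∫⁻ S, ENNReal.ofReal (P.r S (meanVec D)) ∂(actionKernel O ctx (t + 1) s)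
        + ∫⁻ S, g (s, S) ∂(actionKernel O ctx (t + 1) s) := by
    filter_upwards [ae_stateLaw_count_le_and_mem_cube P D O ctx hD t] with s hs
    have hu := ucb_mem_cube (t + 1) hs.2
    obtain ⟨hmem, hβ⟩ := hO (t + 1) _ hu
    rw [← lintegral_add_left hr]
    have hk : actionKernel O ctx (t + 1) s = O (ctx (t + 1)) (ucb (t + 1) s) := by
      rw [actionKernel, Kernel.comap_apply]
    rw [hk]
    set κ := O (ctx (t + 1)) (ucb (t + 1) s)
    set G := {S | α * P.opt (ctx (t + 1)) (ucb (t + 1) s) ≤ P.r S (ucb (t + 1) s)} with hG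
    have hGm : MeasurableSet G := measurableSet_le measurable_const (P.measurable_r _ hu)
    -- Only the success event `G` of the oracle is used: it has mass at least `β`, and the
    -- nonnegative contribution of its complement is discarded in the last step.
    calc ENNReal.ofReal (α * β * o) = ENNReal.ofReal (α * o) * ENNReal.ofReal β := by
          rw [← ENNReal.ofReal_mul (mul_nonneg hα0 (opt_nonneg P hnonneg _))]
          congr 1; ring
      _ ≤ ENNReal.ofReal (α * o) * κ G := by
          gcongr
          exact ENNReal.ofReal_le_of_le_toReal hβ
      _ = ∫⁻ _ in G, ENNReal.ofReal (α * o) ∂κ := by rw [setLIntegral_const]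
      _ ≤ ∫⁻ S in G, (ENNReal.ofReal (P.r S (meanVec D)) + g (s, S)) ∂κ := by
          refine lintegral_mono_ae ?_
          filter_upwards [ae_restrict_of_ae hmem, ae_restrict_mem hGm] with S hS hSG
          have h1 : α * o ≤ P.r S (meanVec D) + P.gap α D (ctx (t + 1)) S := by
            have := le_max_right 0 (α * o - P.r S (meanVec D))
            change α * o ≤ P.r S (meanVec D) + max 0 (α * o - P.r S (meanVec D))
            linarith
          calc ENNReal.ofReal (α * o)
              ≤ ENNReal.ofReal (P.r S (meanVec D) + P.gap α D (ctx (t + 1)) S) :=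
                ENNReal.ofReal_le_ofReal h1
            _ ≤ _ := ENNReal.ofReal_add_le
            _ ≤ _ := by
              gcongr
              exact hgap s hs.2 S hS hSG
      _ ≤ _ := setLIntegral_le_lintegral _ _
  calc ENNReal.ofReal (α * β * o)
      = ∫⁻ _, ENNReal.ofReal (α * β * o) ∂(stateLaw P D O ctx t) := by simp
    _ ≤ _ := lintegral_mono_ae hae

/-- The oracle almost surely plays a feasible action, so its reward is at most the optimum.
Finiteness allows the return from extended nonnegative integrals to the real regret. -/
lemma lintegral_actionLaw_reward_ne_top (hD : D ∈ P.distClass)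
    (hopt : ∀ t, BddAbove ((fun S => P.r S (meanVec D)) '' ctx t))
    (hO : ∀ t, P.IsApproxOracle α β O (ctx t)) (t : ℕ) :
    ∫⁻ S, ENNReal.ofReal (P.r S (meanVec D)) ∂(actionLaw P D O ctx (t + 1)) ≠ ∞ := by
  have hr : Measurable fun S => ENNReal.ofReal (P.r S (meanVec D)) :=
    (P.measurable_r _ (meanVec_mem_cube P hD)).ennreal_ofReal
  rw [lintegral_actionLaw P O ctx D t hr]
  set b := ENNReal.ofReal (P.opt (ctx (t + 1)) (meanVec D))
  refine ne_top_of_le_ne_top (ENNReal.ofReal_ne_top : b ≠ ∞) ?_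
  calc _ ≤ ∫⁻ _, b ∂(stateLaw P D O ctx t) := by
        refine lintegral_mono_ae ?_
        filter_upwards [ae_stateLaw_count_le_and_mem_cube P D O ctx hD t] with s hs
        have hk : actionKernel O ctx (t + 1) s = O (ctx (t + 1)) (ucb (t + 1) s) := by
          rw [actionKernel, Kernel.comap_apply]
        rw [hk]
        calc _ ≤ ∫⁻ _, b ∂(O (ctx (t + 1)) (ucb (t + 1) s)) := by
              refine lintegral_mono_ae ?_
              filter_upwards [(hO (t + 1) _ (ucb_mem_cube (t + 1) hs.2)).1] with S hS
              exact ENNReal.ofReal_le_ofReal (le_csSup (hopt _) (mem_image_of_mem _ hS))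
          _ = b := by simp
    _ = b := by simp

/-- Generic regret bound: a decomposition of the gap into contributions `φ i` of the arms, each of
bounded total size, and a constant `c`. -/
theorem regret_le_of_gap_le (hC : 0 < C) (hmono : P.Monotonicity) (hTPM : P.TPM C)
    (hD : D ∈ P.distClass) (hnonneg : ∀ S : Act, 0 ≤ P.r S (meanVec D))
    (hopt : ∀ t, BddAbove ((fun S => P.r S (meanVec D)) '' ctx t))
    (hα0 : 0 ≤ α) (hα1 : α ≤ 1)
    (hO : ∀ t, P.IsApproxOracle α β O (ctx t)) (T : ℕ)
    (φ : Fin m → ℕ → ℝ) (hφ0 : ∀ i n, 0 ≤ φ i n) {c : ℝ} (hc : 0 ≤ c)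
    (B : Fin m → ℝ) (hB : ∀ i n, ∑ k ∈ Finset.range n, φ i k ≤ B i)
    (hφ : ∀ t ∈ Finset.Icc 1 T, ∀ S ∈ ctx t, ∀ n : Fin m → ℕ,
      P.gap α D (ctx t) S ≤ C * ∑ i, P.trigProb D S i * width T (n i) →
        P.gap α D (ctx t) S ≤ ∑ i, P.trigProb D S i * φ i (n i) + c) :
    regret P D O ctx α β T
      ≤ ∑ i, B i + T * c + C * m + 2 * m * (P.gapMax α D ctx T).toReal := by
  set d := (P.gapMax α D ctx T).toReal with hd
  have hd0 : 0 ≤ d := ENNReal.toReal_nonneg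
  have hB0 : ∀ i, 0 ≤ B i := fun i => by simpa using hB i 0
  -- `a` is the part of an arm to be telescoped along its counter, and `b` is its charge for
  -- deviating below or above.
  let a : Fin m → State m × Act → ℝ≥0∞ := fun i z =>
    ENNReal.ofReal (P.trigProb D z.2 i) * ENNReal.ofReal (φ i (z.1.1 i))
  let b : ℕ → Fin m → State m → ℝ≥0∞ := fun t i s =>
    (deviates (t + 1) (meanVec D i) i (-1)).indicator (fun _ => ENNReal.ofReal (d + C)) s
      + (deviates (t + 1) (meanVec D i) i 1).indicator (fun _ => ENNReal.ofReal d) s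
  let g : ℕ → State m × Act → ℝ≥0∞ := fun t z =>
    ∑ i, (a i z + b t i z.1) + ENNReal.ofReal c
  have ha : ∀ i, Measurable (a i) := by
    intro i
    refine Measurable.mul ((measurable_trigProb P D i).comp measurable_snd).ennreal_ofReal ?_
    exact ((measurable_from_top (f := φ i)).comp
      ((measurable_pi_apply i).comp (measurable_fst.comp measurable_fst))).ennreal_ofReal
  have hb : ∀ t i, Measurable (b t i) := fun t i =>
    (measurable_const.indicator (measurableSet_deviates _ _ _ _)).add
      (measurable_const.indicator (measurableSet_deviates _ _ _ _))
  let E : ℕ → ℝ≥0∞ := fun t =>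
    ∫⁻ s, ∫⁻ S, g t (s, S) ∂(actionKernel O ctx (t + 1) s) ∂(stateLaw P D O ctx t)
  have hround : ∀ t ∈ Finset.range T,
      ENNReal.ofReal (α * β * P.opt (ctx (t + 1)) (meanVec D))
        ≤ ∫⁻ S, ENNReal.ofReal (P.r S (meanVec D)) ∂(actionLaw P D O ctx (t + 1)) + E t := by
    intro t ht
    have ht' : t + 1 ∈ Finset.Icc 1 T := by
      rw [Finset.mem_range] at ht; rw [Finset.mem_Icc]; omega
    refine ofReal_mul_opt_le P O ctx hD hnonneg hα0 hO t ?_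
    intro s hs S hS happ
    refine (ENNReal.ofReal_le_ofReal (gap_le_sum_of_approx_opt P hC hmono hTPM hD hnonneg hα0 hα1
      ctx hopt ht' hs hS happ φ hφ0 hc (hφ _ ht' S hS))).trans ?_
    rw [← hd]
    refine ENNReal.ofReal_add_le.trans ?_
    refine add_le_add ?_ le_rfl
    have hp : ∀ i, 0 ≤ P.trigProb D S i * φ i (s.1 i) :=
      fun i => mul_nonneg (trigProb_nonneg P D S i) (hφ0 i _)
    have hl : ∀ i, 0 ≤ (deviates (t + 1) (meanVec D i) i (-1)).indicator (fun _ => d + C) s :=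
      fun i => indicator_nonneg (fun _ _ => by positivity) _
    have hh : ∀ i, 0 ≤ (deviates (t + 1) (meanVec D i) i 1).indicator (fun _ => d) s :=
      fun i => indicator_nonneg (fun _ _ => hd0) _
    rw [ENNReal.ofReal_sum_of_nonneg fun i _ => add_nonneg (hp i) (add_nonneg (hl i) (hh i))]
    refine Finset.sum_le_sum fun i _ => ?_
    rw [ENNReal.ofReal_add (hp i) (add_nonneg (hl i) (hh i)), ENNReal.ofReal_add (hl i) (hh i),
      ENNReal.ofReal_mul (trigProb_nonneg P D S i)]
    refine add_le_add le_rfl (add_le_add ?_ ?_)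
    · by_cases h : s ∈ deviates (t + 1) (meanVec D i) i (-1) <;> simp [h]
    · by_cases h : s ∈ deviates (t + 1) (meanVec D i) i 1 <;> simp [h]
  have hE : ∀ t, E t = ∑ i, ((∫⁻ s, ∫⁻ S, a i (s, S) ∂(actionKernel O ctx (t + 1) s)
        ∂(stateLaw P D O ctx t))
      + (ENNReal.ofReal (d + C) * stateLaw P D O ctx t (deviates (t + 1) (meanVec D i) i (-1))
        + ENNReal.ofReal d * stateLaw P D O ctx t (deviates (t + 1) (meanVec D i) i 1)))
      + ENNReal.ofReal c := by
    intro t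
    have hinner : ∀ s, ∫⁻ S, g t (s, S) ∂(actionKernel O ctx (t + 1) s)
        = ∑ i, ((∫⁻ S, a i (s, S) ∂(actionKernel O ctx (t + 1) s)) + b t i s)
          + ENNReal.ofReal c := by
      intro s
      have ha' : ∀ i, Measurable fun S => a i (s, S) := fun i =>
        (ha i).comp measurable_prodMk_left
      simp only [g]
      rw [lintegral_add_right _ measurable_const, lintegral_finsetSum _
        fun i _ => (show Measurable fun S => a i (s, S) + b t i s from
          (ha' i).add measurable_const)]
      simp only [lintegral_const, measure_univ, mul_one]
      congr 1
      refine Finset.sum_congr rfl fun i _ => ?_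
      rw [lintegral_add_right _ measurable_const]
      simp
    simp only [E]
    simp_rw [hinner]
    rw [lintegral_add_right _ measurable_const, lintegral_finsetSum _ fun i _ =>
      (show Measurable fun s => ∫⁻ S, a i (s, S) ∂(actionKernel O ctx (t + 1) s) + b t i s from
        (measurable_actionKernel_lintegral O ctx (t + 1) (ha i)).add (hb t i))]
    simp only [lintegral_const, measure_univ, mul_one]
    congr 1
    refine Finset.sum_congr rfl fun i _ => ?_
    rw [lintegral_add_right _ (hb t i)]
    congr 1
    simp only [b]
    rw [lintegral_add_right _ (measurable_const.indicator (measurableSet_deviates _ _ _ _)),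
      lintegral_indicator_const (measurableSet_deviates _ _ _ _),
      lintegral_indicator_const (measurableSet_deviates _ _ _ _)]
  have hsum : ∑ t ∈ Finset.range T, E t
      ≤ ENNReal.ofReal (∑ i, (B i + ((d + C) + d)) + T * c) := by
    simp_rw [hE]
    rw [Finset.sum_add_distrib, Finset.sum_comm,
      ENNReal.ofReal_add (Finset.sum_nonneg fun i _ => by have := hB0 i; positivity)
        (by positivity)]
    refine add_le_add ?_ ?_
    · rw [ENNReal.ofReal_sum_of_nonneg fun i _ => by have := hB0 i; positivity]
      refine Finset.sum_le_sum fun i _ => ?_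
      rw [Finset.sum_add_distrib, Finset.sum_add_distrib, ← Finset.mul_sum, ← Finset.mul_sum,
        ENNReal.ofReal_add (hB0 i) (by positivity), ENNReal.ofReal_add (by positivity) hd0]
      refine add_le_add ?_ (add_le_add ?_ ?_)
      · simp only [a]
        -- After telescoping, the arm contributes a partial sum of `φ i` up to its final counter,
        -- which is at most `B i` whatever that counter is.
        rw [sum_lintegral_trigProb_mul P D O ctx i (fun k => ENNReal.ofReal (φ i k)) T]
        calc _ ≤ ∫⁻ _, ENNReal.ofReal (B i) ∂(stateLaw P D O ctx T) := by
              refine lintegral_mono fun s => ?_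
              rw [← ENNReal.ofReal_sum_of_nonneg fun k _ => hφ0 i k]
              exact ENNReal.ofReal_le_ofReal (hB i _)
          _ = _ := by simp
      · exact mul_le_of_le_one_right' (sum_stateLaw_deviates_le_one P D O ctx hD i (by norm_num) T)
      · exact mul_le_of_le_one_right' (sum_stateLaw_deviates_le_one P D O ctx hD i (by norm_num) T)
    · rw [Finset.sum_const, Finset.card_range, nsmul_eq_mul, ENNReal.ofReal_mul (by positivity),
        ENNReal.ofReal_natCast]
  have hEfin : ∀ t ∈ Finset.range T, E t ≠ ∞ := fun t ht =>
    ne_top_of_le_ne_top ENNReal.ofReal_ne_top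
      ((Finset.single_le_sum (f := E) (fun _ _ => zero_le) ht).trans hsum)
  have hreal : ∀ t ∈ Finset.range T, α * β * P.opt (ctx (t + 1)) (meanVec D)
      ≤ ∫ S, P.r S (meanVec D) ∂(actionLaw P D O ctx (t + 1)) + (E t).toReal := by
    intro t ht
    have hfin := lintegral_actionLaw_reward_ne_top P O ctx hD hopt hO t
    rw [integral_eq_lintegral_of_nonneg_ae (Filter.Eventually.of_forall hnonneg)
      (P.measurable_r _ (meanVec_mem_cube P hD)).aestronglyMeasurable,
      ← ENNReal.toReal_add hfin (hEfin t ht)]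
    exact (ENNReal.ofReal_le_iff_le_toReal (ENNReal.add_ne_top.2 ⟨hfin, hEfin t ht⟩)).1
      (hround t ht)
  have hEsum : ∑ t ∈ Finset.range T, (E t).toReal
      ≤ ∑ i, (B i + ((d + C) + d)) + T * c := by
    rw [← ENNReal.toReal_sum hEfin]
    refine ENNReal.toReal_le_of_le_ofReal ?_ hsum
    exact add_nonneg (Finset.sum_nonneg fun i _ => by have := hB0 i; positivity) (by positivity)
  have hIcc : ∀ f : ℕ → ℝ, ∑ t ∈ Finset.Icc 1 T, f t = ∑ t ∈ Finset.range T, f (t + 1) := by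
    intro f
    rw [← Finset.Ico_succ_right_eq_Icc, Finset.sum_Ico_eq_sum_range]
    simp [add_comm]
  rw [regret, hIcc, hIcc]
  have h1 := Finset.sum_le_sum hreal
  rw [Finset.sum_add_distrib] at h1
  have h2 : ∑ i : Fin m, (B i + ((d + C) + d)) = ∑ i, B i + C * m + 2 * m * d := by
    rw [Finset.sum_add_distrib, Finset.sum_const, Finset.card_univ, Fintype.card_fin,
      nsmul_eq_mul]
    ring
  linarith

end Regret

/-! ### Partial sums of truncated confidence widths -/

section WidthSum

/-- The minimiser `θ = √(a/b)` is not admissible when `a` or `b` is 0, which happens for `m = 0` or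
`K = 0`. Both are therefore shifted by `δ > 0`, and `δ` tends to 0. -/
lemma le_two_mul_sqrt_of_forall_le_div_add_mul {a b x : ℝ} (ha : 0 ≤ a) (hb : 0 ≤ b)
    (h : ∀ θ : ℝ, 0 < θ → x ≤ a / θ + b * θ) : x ≤ 2 * Real.sqrt (a * b) := by
  have hδ : ∀ δ : ℝ, 0 < δ → x ≤ 2 * Real.sqrt ((a + δ) * (b + δ)) := by
    intro δ hδ
    have hA : 0 < Real.sqrt (a + δ) := Real.sqrt_pos.2 (by linarith)
    have hB : 0 < Real.sqrt (b + δ) := Real.sqrt_pos.2 (by linarith)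
    set u := Real.sqrt (a + δ)
    set v := Real.sqrt (b + δ)
    have hu : u ^ 2 = a + δ := Real.sq_sqrt (by linarith)
    have hv : v ^ 2 = b + δ := Real.sq_sqrt (by linarith)
    have hθ : 0 < u / v := by positivity
    calc x ≤ a / (u / v) + b * (u / v) := h _ hθ
      _ ≤ u ^ 2 / (u / v) + v ^ 2 * (u / v) := by
          gcongr <;> linarith
      _ = 2 * (u * v) := by field_simp; ring
      _ = _ := by rw [Real.sqrt_mul (by linarith)]
  have hcont : Continuous fun δ : ℝ => 2 * Real.sqrt ((a + δ) * (b + δ)) := by fun_prop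
  have hlim : Filter.Tendsto (fun δ : ℝ => 2 * Real.sqrt ((a + δ) * (b + δ)))
      (nhdsWithin 0 (Ioi 0)) (nhds (2 * Real.sqrt (a * b))) := by
    have := (hcont.tendsto 0).mono_left (nhdsWithin_le_nhds (s := Ioi (0 : ℝ)))
    simpa using this
  exact ge_of_tendsto hlim (by filter_upwards [self_mem_nhdsWithin] with δ hpos using hδ δ hpos)

/-- The total excess of the confidence width over a threshold. -/
lemma sum_max_width_sub_le (T : ℕ) {θ : ℝ} (hθ : 0 < θ) (n : ℕ) :
    ∑ k ∈ Finset.range n, max 0 (width T k - θ) ≤ 1 + 6 * Real.log T / θ := by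
  set a := 6 * Real.log T with ha
  have ha0 : 0 ≤ a := mul_nonneg (by norm_num) (Real.log_natCast_nonneg _)
  have haθ : 0 ≤ a / θ := by positivity
  -- Completing the square: the difference is `(√a - θ x)² / θ`.
  have hf : ∀ x : ℝ, 2 * Real.sqrt a * x - θ * x ^ 2 ≤ a / θ := by
    intro x
    rw [le_div_iff₀ hθ]
    nlinarith [sq_nonneg (Real.sqrt a - θ * x), Real.sq_sqrt ha0]
  have hwidth : ∀ k : ℕ, width T (k + 1) = Real.sqrt a / Real.sqrt ((k : ℝ) + 1) := by
    intro k
    rw [width, if_neg (by omega), ← ha, Real.sqrt_div ha0]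
    push_cast
    rfl
  -- From `1/√(k+1) ≤ 2 (√(k+1) - √k)`. Writing `θ` as a difference of `θ √k ^ 2` makes the whole
  -- summand telescope to the quadratic in `√n` bounded by `hf`.
  have hstep : ∀ k : ℕ, width T (k + 1) - θ ≤
      (2 * Real.sqrt a * Real.sqrt ((k : ℝ) + 1) - θ * Real.sqrt ((k : ℝ) + 1) ^ 2)
        - (2 * Real.sqrt a * Real.sqrt (k : ℝ) - θ * Real.sqrt (k : ℝ) ^ 2) := by
    intro k
    have hk : (0 : ℝ) ≤ k := by positivity
    have hs : 0 < Real.sqrt ((k : ℝ) + 1) := Real.sqrt_pos.2 (by positivity)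
    have h1 : Real.sqrt ((k : ℝ) + 1) ^ 2 = k + 1 := Real.sq_sqrt (by positivity)
    have h2 : Real.sqrt (k : ℝ) ^ 2 = k := Real.sq_sqrt hk
    rw [hwidth]
    have h3 : 1 / Real.sqrt ((k : ℝ) + 1)
        ≤ 2 * Real.sqrt ((k : ℝ) + 1) - 2 * Real.sqrt (k : ℝ) := by
      rw [div_le_iff₀ hs]
      nlinarith [sq_nonneg (Real.sqrt ((k : ℝ) + 1) - Real.sqrt (k : ℝ))]
    have h4 := mul_le_mul_of_nonneg_left h3 (Real.sqrt_nonneg a)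
    rw [mul_one_div] at h4
    rw [h1, h2]
    linarith
  have hanti : ∀ j k : ℕ, j ≤ k → width T (k + 1) ≤ width T (j + 1) := by
    intro j k hjk
    rw [hwidth, hwidth]
    gcongr
  have hmain_pos : ∀ n : ℕ, (∀ k < n, 0 ≤ width T (k + 1) - θ) →
      ∑ k ∈ Finset.range n, max 0 (width T (k + 1) - θ) ≤ a / θ := by
    intro n hpos
    calc _ ≤ ∑ k ∈ Finset.range n,
          ((2 * Real.sqrt a * Real.sqrt ((k + 1 : ℕ) : ℝ)
              - θ * Real.sqrt ((k + 1 : ℕ) : ℝ) ^ 2)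
            - (2 * Real.sqrt a * Real.sqrt (k : ℝ) - θ * Real.sqrt (k : ℝ) ^ 2)) := by
          refine Finset.sum_le_sum fun k hk => ?_
          rw [max_eq_right (hpos k (Finset.mem_range.1 hk))]
          push_cast
          exact hstep k
      _ ≤ _ := by
          rw [Finset.sum_range_sub (fun k : ℕ => 2 * Real.sqrt a * Real.sqrt (k : ℝ)
            - θ * Real.sqrt (k : ℝ) ^ 2)]
          simpa using hf (Real.sqrt n)
  -- Widths decrease, so once one of them is below `θ` all later terms vanish; only an initial
  -- segment of nonnegative terms matters.
  have hmain : ∀ n : ℕ, ∑ k ∈ Finset.range n, max 0 (width T (k + 1) - θ) ≤ a / θ := by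
    intro n
    induction n with
    | zero => simpa using haθ
    | succ n ih =>
      by_cases hpos : ∀ k < n + 1, 0 ≤ width T (k + 1) - θ
      · exact hmain_pos (n + 1) hpos
      · push Not at hpos
        obtain ⟨k, hk, hk'⟩ := hpos
        rw [Finset.sum_range_succ, max_eq_left (by linarith [hanti k n (by omega)]), add_zero]
        exact ih
  cases n with
  | zero => simpa using by positivity
  | succ n =>
    rw [Finset.sum_range_succ']
    -- An unobserved arm has width 1, which accounts for the constant 1 in the bound.
    have h0 : max 0 (width T 0 - θ) ≤ 1 := by
      rw [width, if_pos rfl]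
      exact max_le zero_le_one (by linarith)
    linarith [hmain n]

end WidthSum

/-! ### Splitting the gap among the arms -/

section Decomposition

variable (P : Problem Act m) {D : ProbabilityMeasure (Fin m → ℝ)} {C α : ℝ}
  (ctx : ℕ → Set Act) {T t : ℕ} {S : Act}

lemma sum_ite_trigProb_le (ht : t ∈ Finset.Icc 1 T) (hS : S ∈ ctx t) :
    ∑ i, (if 0 < P.trigProb D S i then (1 : ℝ) else 0) ≤ P.maxTrig D ctx T := by
  have h := ncard_triggerable_le_maxTrig P (D := D) ctx ht hS
  have e : {i | 0 < P.trigProb D S i}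
      = ((Finset.univ.filter fun i => 0 < P.trigProb D S i : Finset (Fin m)) : Set (Fin m)) := by
    ext; simp
  rw [e, ncard_coe_finset] at h
  rw [Finset.sum_boole]
  exact_mod_cast h

/-- Threshold decomposition of the gap with the reverse amortization trick. -/
lemma gap_le_sum_of_gapMinArm (hC : 0 < C) (hmin : 0 < P.gapMin α D ctx T)
    (ht : t ∈ Finset.Icc 1 T) (hS : S ∈ ctx t) (n : Fin m → ℕ)
    (h : P.gap α D (ctx t) S ≤ C * ∑ i, P.trigProb D S i * width T (n i)) :
    P.gap α D (ctx t) S ≤ ∑ i, P.trigProb D S i *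
      (if (P.maxTrig D ctx T : ℝ) * ((P.gapMinArm α D ctx T i)⁻¹).toReal = 0 then 0
        else 2 * C * max 0 (width T (n i) - 1 / (2 * C * (P.maxTrig D ctx T : ℝ)
          * ((P.gapMinArm α D ctx T i)⁻¹).toReal))) := by
  set Δ := P.gap α D (ctx t) S
  set K : ℝ := (P.maxTrig D ctx T : ℝ) with hK
  set H : Fin m → ℝ := fun i => ((P.gapMinArm α D ctx T i)⁻¹).toReal
  have hp0 := trigProb_nonneg P D S
  rcases (P.gap_nonneg (ctx t) S : 0 ≤ Δ).eq_or_lt with h0 | hpos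
  · rw [show Δ = 0 from h0.symm]
    refine Finset.sum_nonneg fun i _ => mul_nonneg (hp0 i) ?_
    split_ifs
    · exact le_rfl
    · positivity
  -- For a triggerable arm `Δ_min^{i,T}` is positive by `hmin` and finite because this gap bounds
  -- it, so `H i` is its true reciprocal and not a default value.
  have hHΔ : ∀ i, 0 < P.trigProb D S i → 0 < H i ∧ 1 / H i ≤ Δ := by
    intro i hi
    have h1 := gapMinArm_le_gap P ctx ht hS hi hpos
    have h2 : P.gapMinArm α D ctx T i ≠ ∞ := ne_top_of_le_ne_top ENNReal.ofReal_ne_top h1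
    have h3 : 0 < P.gapMinArm α D ctx T i := hmin.trans_le (iInf_le _ i)
    have h4 : H i = (P.gapMinArm α D ctx T i).toReal⁻¹ := ENNReal.toReal_inv _
    have h5 : 0 < (P.gapMinArm α D ctx T i).toReal := ENNReal.toReal_pos h3.ne' h2
    rw [h4]
    refine ⟨by positivity, ?_⟩
    rw [one_div, inv_inv]
    exact ENNReal.toReal_le_of_le_ofReal hpos.le h1
  have hcount := sum_ite_trigProb_le P (D := D) ctx ht hS
  rw [← hK] at hcount
  -- Doubling the hypothesis and moving one `Δ` across gives `Δ ≤ 2C ∑ p_i w_i - Δ`. The subtracted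
  -- `Δ` is shared as `Δ/K` among the at most `K` triggerable arms. Each share is at least `p_i
  -- Δ_min^{i,T} / K`, so the width is lowered by `Δ_min^{i,T} / (2CK)`.
  have hterm : ∀ i, 2 * (C * (P.trigProb D S i * width T (n i)))
      - (if 0 < P.trigProb D S i then (1 : ℝ) else 0) * (Δ / K) ≤ P.trigProb D S i *
      (if K * H i = 0 then 0 else 2 * C * max 0 (width T (n i) - 1 / (2 * C * K * H i))) := by
    intro i
    rcases (hp0 i).eq_or_lt with hi | hi
    · simp [← hi]
    · obtain ⟨hHi, hle⟩ := hHΔ i hi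
      have hK1 : 0 < K := by
        refine lt_of_lt_of_le one_pos (le_trans ?_ hcount)
        have := Finset.single_le_sum
          (f := fun i => if 0 < P.trigProb D S i then (1 : ℝ) else 0)
          (fun j _ => by positivity) (Finset.mem_univ i)
        simpa [hi] using this
      rw [if_pos hi, if_neg (mul_pos hK1 hHi).ne']
      have h1 : P.trigProb D S i * (1 / H i / K) ≤ Δ / K := by
        refine (mul_le_of_le_one_left (by positivity) (trigProb_le_one P D S i)).trans ?_
        gcongr
      have h2 : P.trigProb D S i * (2 * C * (width T (n i) - 1 / (2 * C * K * H i)))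
          ≤ P.trigProb D S i * (2 * C * max 0 (width T (n i) - 1 / (2 * C * K * H i))) := by
        gcongr
        exact le_max_right _ _
      have h3 : P.trigProb D S i * (2 * C * (width T (n i) - 1 / (2 * C * K * H i)))
          = 2 * (C * (P.trigProb D S i * width T (n i))) - P.trigProb D S i * (1 / H i / K) := by
        field_simp
      linarith
  have hsum := Finset.sum_le_sum fun i (_ : i ∈ Finset.univ) => hterm i
  rw [Finset.sum_sub_distrib, ← Finset.mul_sum, ← Finset.mul_sum, ← Finset.sum_mul] at hsum
  have hlast : (∑ i, if 0 < P.trigProb D S i then (1 : ℝ) else 0) * (Δ / K) ≤ Δ := by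
    have hK0 : 0 ≤ K := by positivity
    calc _ ≤ K * (Δ / K) := by gcongr
      _ ≤ Δ := by
          rw [mul_div_assoc']
          exact div_le_of_le_mul₀ hK0 hpos.le (by rw [mul_comm])
  refine le_trans ?_ hsum
  linarith

/-- Decomposition of the gap with a common threshold. -/
lemma gap_le_sum_add_of_threshold (hC : 0 < C) {θ : ℝ} (hθ : 0 ≤ θ)
    (ht : t ∈ Finset.Icc 1 T) (hS : S ∈ ctx t) (n : Fin m → ℕ)
    (h : P.gap α D (ctx t) S ≤ C * ∑ i, P.trigProb D S i * width T (n i)) :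
    P.gap α D (ctx t) S ≤ ∑ i, P.trigProb D S i * (C * max 0 (width T (n i) - θ))
      + C * (P.maxTrig D ctx T : ℝ) * θ := by
  have hcount := sum_ite_trigProb_le P (D := D) ctx ht hS
  have hterm : ∀ i, C * (P.trigProb D S i * width T (n i))
      ≤ P.trigProb D S i * (C * max 0 (width T (n i) - θ))
        + (if 0 < P.trigProb D S i then (1 : ℝ) else 0) * (C * θ) := by
    intro i
    rcases (trigProb_nonneg P D S i).eq_or_lt with hi | hi
    · simp [← hi]
    · rw [if_pos hi]
      have h1 : P.trigProb D S i * (C * (width T (n i) - θ))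
          ≤ P.trigProb D S i * (C * max 0 (width T (n i) - θ)) := by
        gcongr
        exact le_max_right _ _
      have h2 : P.trigProb D S i * (C * θ) ≤ 1 * (C * θ) := by
        gcongr
        exact trigProb_le_one P D S i
      linarith
  have hsum := Finset.sum_le_sum fun i (_ : i ∈ Finset.univ) => hterm i
  rw [Finset.sum_add_distrib, ← Finset.mul_sum, ← Finset.sum_mul] at hsum
  refine (h.trans hsum).trans ?_
  have : (∑ i, if 0 < P.trigProb D S i then (1 : ℝ) else 0) * (C * θ)
      ≤ (P.maxTrig D ctx T : ℝ) * (C * θ) := by gcongr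
  linarith

end Decomposition

/-! ### The two regret bounds -/

section Main

variable (P : Problem Act m) {D : ProbabilityMeasure (Fin m → ℝ)} {C α β : ℝ}
  (O : Set Act → Kernel (Fin m → ℝ) Act) [∀ A, IsMarkovKernel (O A)] (ctx : ℕ → Set Act)

/-- Gap-dependent regret bound. -/
theorem regret_le_gap_dependent (hC : 0 < C) (hmono : P.Monotonicity) (hTPM : P.TPM C)
    (hD : D ∈ P.distClass) (hnonneg : ∀ S : Act, 0 ≤ P.r S (meanVec D))
    (hopt : ∀ t, BddAbove ((fun S => P.r S (meanVec D)) '' ctx t))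
    (hα0 : 0 ≤ α) (hα1 : α ≤ 1) (hO : ∀ t, P.IsApproxOracle α β O (ctx t)) (T : ℕ)
    (hmin : 0 < P.gapMin α D ctx T) :
    regret P D O ctx α β T
      ≤ ∑ i : Fin m, 24 * C ^ 2 * (P.maxTrig D ctx T : ℝ) * Real.log T
            * ((P.gapMinArm α D ctx T i)⁻¹).toReal
        + 3 * C * m + 2 * m * (P.gapMax α D ctx T).toReal := by
  have hlog : 0 ≤ Real.log T := Real.log_natCast_nonneg _
  have h := regret_le_of_gap_le P O ctx hC hmono hTPM hD hnonneg hopt hα0 hα1 hO T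
    -- The case `K H = 0` stands for an infinite threshold. Division by zero would give threshold 0
    -- instead, and the partial sums of the plain widths are not controlled by `B i`.
    (fun i n => if (P.maxTrig D ctx T : ℝ) * ((P.gapMinArm α D ctx T i)⁻¹).toReal = 0
        then 0
        else 2 * C * max 0 (width T n - 1 / (2 * C * (P.maxTrig D ctx T : ℝ)
          * ((P.gapMinArm α D ctx T i)⁻¹).toReal)))
    (fun i n => by
      split_ifs
      · exact le_rfl
      · positivity) le_rfl
    (fun i => 24 * C ^ 2 * (P.maxTrig D ctx T : ℝ) * Real.log T
            * ((P.gapMinArm α D ctx T i)⁻¹).toReal + 2 * C)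
    (fun i n => ?_)
    (fun t ht S hS n hn => by
      rw [add_zero]
      exact gap_le_sum_of_gapMinArm P ctx hC hmin ht hS n hn)
  · rw [Finset.sum_add_distrib, Finset.sum_const, Finset.card_univ, Fintype.card_fin,
      nsmul_eq_mul] at h
    linarith
  · set H := ((P.gapMinArm α D ctx T i)⁻¹).toReal
    have hH0 : 0 ≤ H := ENNReal.toReal_nonneg
    set K : ℝ := (P.maxTrig D ctx T : ℝ)
    have hK0 : 0 ≤ K := Nat.cast_nonneg _
    rcases (mul_nonneg hK0 hH0).eq_or_lt with h0 | hpos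
    · simp only [← h0, if_true, Finset.sum_const_zero]
      positivity
    · simp only [hpos.ne', if_false]
      rw [← Finset.mul_sum, mul_assoc (2 * C) K H]
      have h1 : 0 < 1 / (2 * C * (K * H)) := by positivity
      -- The threshold `1/(2CKH)` turns the width sum into `2C + 24 C² K H ln T`.
      calc _ ≤ 2 * C * (1 + 6 * Real.log T / (1 / (2 * C * (K * H)))) := by
            gcongr
            exact sum_max_width_sub_le T h1 n
        _ = _ := by rw [div_div_eq_mul_div]; ring

/-- Gap-independent regret bound. -/
theorem regret_le_gap_independent (hC : 0 < C) (hmono : P.Monotonicity) (hTPM : P.TPM C)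
    (hD : D ∈ P.distClass) (hnonneg : ∀ S : Act, 0 ≤ P.r S (meanVec D))
    (hopt : ∀ t, BddAbove ((fun S => P.r S (meanVec D)) '' ctx t))
    (hα0 : 0 ≤ α) (hα1 : α ≤ 1) (hO : ∀ t, P.IsApproxOracle α β O (ctx t)) (T : ℕ)
    (hT : 2 ≤ T) :
    regret P D O ctx α β T
      ≤ 12 * C * Real.sqrt (m * (P.maxTrig D ctx T : ℝ) * T * Real.log T)
        + 2 * C * m + 2 * m * (P.gapMax α D ctx T).toReal := by
  set K : ℝ := (P.maxTrig D ctx T : ℝ) with hK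
  have hK0 : 0 ≤ K := by positivity
  have hT0 : (0 : ℝ) < T := by positivity
  have hlog : 0 < Real.log T := Real.log_pos (by exact_mod_cast hT)
  have key : ∀ θ : ℝ, 0 < θ → regret P D O ctx α β T ≤ m * (C * (1 + 6 * Real.log T / θ))
      + T * (C * K * θ) + C * m + 2 * m * (P.gapMax α D ctx T).toReal := by
    intro θ hθ
    have h := regret_le_of_gap_le P O ctx hC hmono hTPM hD hnonneg hopt hα0 hα1 hO T
      (fun _ n => C * max 0 (width T n - θ)) (fun _ _ => by positivity)
      (c := C * K * θ) (by positivity) (fun _ => C * (1 + 6 * Real.log T / θ))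
      (fun i n => by
        rw [← Finset.mul_sum]
        gcongr
        exact sum_max_width_sub_le T hθ n)
      (fun t ht S hS n hn => gap_le_sum_add_of_threshold P ctx hC hθ.le ht hS n hn)
    rw [Finset.sum_const, Finset.card_univ, Fintype.card_fin, nsmul_eq_mul] at h
    exact h
  have hbound := le_two_mul_sqrt_of_forall_le_div_add_mul (a := 6 * m * Real.log T) (b := K * T)
    (x := (regret P D O ctx α β T - 2 * C * m - 2 * m * (P.gapMax α D ctx T).toReal) / C)
    (by positivity) (by positivity) fun θ hθ => by
      rw [div_le_iff₀ hC]
      have h := key θ hθ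
      have e : m * (C * (1 + 6 * Real.log T / θ)) + T * (C * K * θ) + C * m
          = (6 * m * Real.log T / θ + K * T * θ) * C + 2 * C * m := by ring
      linarith
  rw [div_le_iff₀ hC] at hbound
  -- The optimised constant is `2√6`; the cruder `√6 ≤ 6` already gives the required 12.
  have hsqrt : Real.sqrt (6 * m * Real.log T * (K * T))
      ≤ 6 * Real.sqrt (m * K * T * Real.log T) := by
    rw [show 6 * m * Real.log T * (K * T) = 6 * (m * K * T * Real.log T) by ring,
      Real.sqrt_mul (by norm_num)]
    gcongr
    rw [Real.sqrt_le_left (by norm_num)]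
    norm_num
  have := mul_le_mul_of_nonneg_right hsqrt hC.le
  linarith

end Main

end C2MAB

end

/-! ### Comparison with the claimed constants -/

theorem mainTheorem9 {Act : Type*} [MeasurableSpace Act] {m : ℕ} (P : C2MAB.Problem Act m)
    (C : ℝ) (hC : 0 < C) (hmono : P.Monotonicity) (hTPM : P.TPM C)
    (D : MeasureTheory.ProbabilityMeasure (Fin m → ℝ)) (hD : D ∈ P.distClass)
    (hnonneg : ∀ S : Act, 0 ≤ P.r S (C2MAB.meanVec D))
    (ctx : ℕ → Set Act)
    (hopt : ∀ t, BddAbove ((fun S => P.r S (C2MAB.meanVec D)) '' ctx t))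
    (α β : ℝ) (hα0 : 0 ≤ α) (hα1 : α ≤ 1) (hβ0 : 0 ≤ β) (hβ1 : β ≤ 1)
    (O : Set Act → ProbabilityTheory.Kernel (Fin m → ℝ) Act)
    [∀ A, ProbabilityTheory.IsMarkovKernel (O A)]
    (hO : ∀ t, P.IsApproxOracle α β O (ctx t)) (T : ℕ) :
    (0 < P.gapMin α D ctx T →
      C2MAB.regret P D O ctx α β T ≤
        ∑ i : Fin m, 576 * C ^ 2 * (P.maxTrig D ctx T : ℝ) * Real.log T
            * ((P.gapMinArm α D ctx T i)⁻¹).toReal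
          + 4 * C * m
          + ∑ i : Fin m,
            ((⌈Real.logb 2 (2 * C * (P.maxTrig D ctx T : ℝ)
                * ((P.gapMinArm α D ctx T i)⁻¹).toReal)⌉₊ : ℝ) + 2)
              * (Real.pi ^ 2 / 6) * (P.gapMax α D ctx T).toReal) ∧
    (2 ≤ T →
      C2MAB.regret P D O ctx α β T ≤
        12 * C * Real.sqrt (m * (P.maxTrig D ctx T : ℝ) * T * Real.log T)
          + 2 * C * m
          + ((⌈Real.logb 2 ((T : ℝ) / (18 * Real.log T))⌉₊ : ℝ) + 2)
              * m * (Real.pi ^ 2 / 6) * (P.gapMax α D ctx T).toReal) := by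
  have hd : 0 ≤ (P.gapMax α D ctx T).toReal := ENNReal.toReal_nonneg
  have hpi : 1 ≤ Real.pi ^ 2 / 6 := by nlinarith [Real.pi_gt_three]
  -- Since `π²/6 ≥ 1`, the coefficient 2 obtained for `Δ_max` lies below `(k + 2) π²/6` for every
  -- natural `k`, so the value of the logarithmic ceiling plays no role.
  have hcoef : ∀ k : ℕ, 2 * (P.gapMax α D ctx T).toReal
      ≤ ((k : ℝ) + 2) * (Real.pi ^ 2 / 6) * (P.gapMax α D ctx T).toReal := by
    intro k
    have hk : (2 : ℝ) * 1 ≤ ((k : ℝ) + 2) * (Real.pi ^ 2 / 6) := by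
      gcongr
      linarith [(Nat.cast_nonneg k : (0 : ℝ) ≤ k)]
    rw [mul_one] at hk
    gcongr
  have hCm : 0 ≤ C * (m : ℝ) := by positivity
  refine ⟨fun hmin => ?_, fun hT => ?_⟩
  · have h := C2MAB.regret_le_gap_dependent P O ctx hC hmono hTPM hD hnonneg hopt hα0 hα1 hO T hmin
    have h1 : ∑ i : Fin m, 24 * C ^ 2 * (P.maxTrig D ctx T : ℝ) * Real.log T
          * ((P.gapMinArm α D ctx T i)⁻¹).toReal
        ≤ ∑ i : Fin m, 576 * C ^ 2 * (P.maxTrig D ctx T : ℝ) * Real.log T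
          * ((P.gapMinArm α D ctx T i)⁻¹).toReal := by
      have hlog : 0 ≤ Real.log T := Real.log_natCast_nonneg _
      gcongr
      norm_num
    have h2 : (m : ℝ) * (2 * (P.gapMax α D ctx T).toReal) ≤ ∑ i : Fin m,
          ((⌈Real.logb 2 (2 * C * (P.maxTrig D ctx T : ℝ)
            * ((P.gapMinArm α D ctx T i)⁻¹).toReal)⌉₊ : ℝ) + 2)
          * (Real.pi ^ 2 / 6) * (P.gapMax α D ctx T).toReal := by
      have := Finset.sum_le_sum fun (i : Fin m) (_ : i ∈ Finset.univ) =>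
        hcoef ⌈Real.logb 2 (2 * C * (P.maxTrig D ctx T : ℝ)
          * ((P.gapMinArm α D ctx T i)⁻¹).toReal)⌉₊
      rwa [Finset.sum_const, Finset.card_univ, Fintype.card_fin, nsmul_eq_mul] at this
    linarith
  · have h := C2MAB.regret_le_gap_independent P O ctx hC hmono hTPM hD hnonneg hopt hα0 hα1 hO T hT
    have h1 := mul_le_mul_of_nonneg_left
      (hcoef ⌈Real.logb 2 ((T : ℝ) / (18 * Real.log T))⌉₊) (Nat.cast_nonneg m : (0 : ℝ) ≤ m)
    linarith
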